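/- Let $M$ be a connected (finite-dimensional, smooth) symmetric space with symmetries $s_p$, $p\in M$, and let $(V,\Omega)$ be a finite-dimensional real symplectic vector space. An *extrinsic symplectic immersion* of $M$ into $(V,\Omega)$ is a smooth immersion $\phi:M\to V$ such that for every $p\in M$ the form $\Omega$ is non-degenerate on $T_p:=d\phi_p(T_pM)$ and $\phi\circ s_p=\sigma_{(T_p,\phi(p))}\circ\phi$, where $\sigma_{(W,v)}:V\to V$ is the affine map that fixes $v$ and whose linear part is $-\mathrm{Id}$ on $W$ and $+\mathrm{Id}$ on the $\Omega$-orthogonal complement of $W$. It is *full* if $\phi(M)$ is contained in no proper affine subspace of $V$. It makes $M$ a symplectic symmetric space with the invariant symplectic form $\omega=\phi^*\Omega$. For $o\in M$ let $\mathfrak g=[\mathfrak p,\mathfrak p]\oplus\mathfrak p$ be the Lie algebra of the transvection group, $\mathfrak p\cong T_oM$, and let $R(x,y)z=-[[x,y],z]$ be the curvature. There are linearly independent $A_1,\dots,A_n\in\mathfrak{sp}(T_oM,\omega_o)$ and a non-degenerate skew-symmetric matrix $(a_{ij})$ with $$R(x,y)=\tfrac12\sum_{i,j}a_{ij}\big((A_ix)\circ(A_jy)-(A_iy)\circ(A_jx)\big),\qquad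 (u\circ v)z:=\omega(u,z)v+\omega(v,z)u,$$ and $n$, the rank of $\mathcal R=\sum a_{ij}A_i\wedge A_j\in\Lambda^2\mathfrak{sp}(T_oM,\omega_o)$, is the *symplectic curvature rank* $\mathrm{srk}(M,\omega)$; it does not depend on $o$. **Corollary D.** Let $\phi:M\to(V,\Omega)$ be an extrinsic symplectic immersion and let $\omega=\phi^*\Omega$. Then $\phi$ is full if and only if $V$ has the smallest dimension among the ambient spaces $V'$ of all extrinsic symplectic immersions $\psi:M\to(V',\Omega')$ with $\psi^*\Omega'=\omega$. This smallest dimension is attained and equals $\dim M+\mathrm{srk}(M,\omega)$. -/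

import Mathlib

open scoped Manifold ContDiff Topology

universe u w v

noncomputable section

/-! ### Symplectic vector spaces and reflections -/

/-- A symplectic form on a real vector space: an alternating, non-degenerate bilinear form. -/
structure IsSymplecticForm {V : Type*} [AddCommGroup V] [Module ℝ V]
    (Ω : LinearMap.BilinForm ℝ V) : Prop where
  isAlt : Ω.IsAlt
  nondegenerate : Ω.Nondegenerate

/-- If `Ω` is symplectic and `Ω|_W` is non-degenerate, then `V = W ⊕ W^⊥`. -/
theorem IsSymplecticForm.isCompl {V : Type*} [AddCommGroup V] [Module ℝ V]
    [FiniteDimensional ℝ V] {Ω : LinearMap.BilinForm ℝ V} (hΩ : IsSymplecticForm Ω)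
    {W : Submodule ℝ V} (hW : (Ω.restrict W).Nondegenerate) :
    IsCompl W (Ω.orthogonal W) :=
  LinearMap.BilinForm.isCompl_orthogonal_of_restrict_nondegenerate hΩ.isAlt.isRefl hW

/-- The linear part of a symplectic reflection: `-id` on `W` and `id` on the `Ω`-orthogonal
complement of `W`. -/
def symplecticReflectionLinear {V : Type*} [AddCommGroup V] [Module ℝ V]
    [FiniteDimensional ℝ V] {Ω : LinearMap.BilinForm ℝ V} (hΩ : IsSymplecticForm Ω)
    {W : Submodule ℝ V} (hW : (Ω.restrict W).Nondegenerate) : V →ₗ[ℝ] V :=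
  LinearMap.id - (2 : ℝ) • W.projection (Ω.orthogonal W) (hΩ.isCompl hW)

/-- The reflection `σ_(W, p)`: the affine map of `V` that fixes `p` and whose linear part is `-id`
on `W` and `id` on the `Ω`-orthogonal complement of `W`. -/
def symplecticReflection {V : Type*} [AddCommGroup V] [Module ℝ V]
    [FiniteDimensional ℝ V] {Ω : LinearMap.BilinForm ℝ V} (hΩ : IsSymplecticForm Ω)
    {W : Submodule ℝ V} (hW : (Ω.restrict W).Nondegenerate) (p : V) : V →ᵃ[ℝ] V where
  toFun x := symplecticReflectionLinear hΩ hW (x - p) + p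
  linear := symplecticReflectionLinear hΩ hW
  map_vadd' x v := by
    simp only [vadd_eq_add]
    rw [← add_assoc, ← map_add, add_sub_assoc]

theorem symplecticReflection_self {V : Type*} [AddCommGroup V] [Module ℝ V]
    [FiniteDimensional ℝ V] {Ω : LinearMap.BilinForm ℝ V} (hΩ : IsSymplecticForm Ω)
    {W : Submodule ℝ V} (hW : (Ω.restrict W).Nondegenerate) (p : V) :
    symplecticReflection hΩ hW p p = p := by
  simp [symplecticReflection]

theorem symplecticReflection_linear_of_mem {V : Type*} [AddCommGroup V] [Module ℝ V]
    [FiniteDimensional ℝ V] {Ω : LinearMap.BilinForm ℝ V} (hΩ : IsSymplecticForm Ω)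
    {W : Submodule ℝ V} (hW : (Ω.restrict W).Nondegenerate) (p : V) {w : V} (hw : w ∈ W) :
    (symplecticReflection hΩ hW p).linear w = -w := by
  have h : W.projection (Ω.orthogonal W) (hΩ.isCompl hW) w = w :=
    Submodule.projection_apply_left (hΩ.isCompl hW) ⟨w, hw⟩
  simp only [symplecticReflection, symplecticReflectionLinear, LinearMap.sub_apply,
    LinearMap.id_apply, LinearMap.smul_apply, h]
  module

theorem symplecticReflection_linear_of_mem_orthogonal {V : Type*} [AddCommGroup V] [Module ℝ V]
    [FiniteDimensional ℝ V] {Ω : LinearMap.BilinForm ℝ V} (hΩ : IsSymplecticForm Ω)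
    {W : Submodule ℝ V} (hW : (Ω.restrict W).Nondegenerate) (p : V) {w : V}
    (hw : w ∈ Ω.orthogonal W) :
    (symplecticReflection hΩ hW p).linear w = w := by
  have h : W.projection (Ω.orthogonal W) (hΩ.isCompl hW) w = 0 :=
    (Submodule.projection_apply_eq_zero_iff (hΩ.isCompl hW)).2 hw
  simp [symplecticReflection, symplecticReflectionLinear, h]

/-! ### The rank of a formal curvature of `sp(P, θ)` -/

/-- `A ∈ sp(P, θ)`. -/
def IsInfinitesimallySymplectic {P : Type*} [AddCommGroup P] [Module ℝ P]
    (θ : LinearMap.BilinForm ℝ P) (A : P →ₗ[ℝ] P) : Prop :=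
  ∀ x y : P, θ (A x) y + θ x (A y) = 0

/-- The element `x ∘ y` of `sp(P, θ)`, given by `(x ∘ y) z = θ(x, z) y + θ(y, z) x`. -/
def symProduct {P : Type*} [AddCommGroup P] [Module ℝ P]
    (θ : LinearMap.BilinForm ℝ P) (x y : P) : P →ₗ[ℝ] P :=
  (θ x).smulRight y + (θ y).smulRight x

/-- The curvature `R` is represented by a bivector of rank `n`, that is, by
`𝓡 = ∑ i j, a i j • (A i ∧ A j) ∈ Λ² sp(P, θ)` with a non-degenerate skew-symmetric `n × n` matrix
`a` and linearly independent `A 1, …, A n ∈ sp(P, θ)`: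
`R(x, y) = ½ ∑ i j, a i j • ((A i x) ∘ (A j y) - (A i y) ∘ (A j x))`. -/
def IsRepresentedByBivectorOfRank {P : Type*} [AddCommGroup P] [Module ℝ P]
    (θ : LinearMap.BilinForm ℝ P) (R : P → P → P → P) (n : ℕ) : Prop :=
  ∃ (a : Matrix (Fin n) (Fin n) ℝ) (A : Fin n → (P →ₗ[ℝ] P)),
    a.transpose = -a ∧ IsUnit a.det ∧
    LinearIndependent ℝ A ∧ (∀ i, IsInfinitesimallySymplectic θ (A i)) ∧
    ∀ x y z : P, R x y z = (1 / 2 : ℝ) • ∑ i, ∑ j, a i j •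
      (symProduct θ (A i x) (A j y) z - symProduct θ (A i y) (A j x) z)

/-- The rank of the bivector `𝓡 ∈ Λ² sp(P, θ)` that represents `R`. As `𝓡 ↦ R` is an isomorphism
from `Λ² sp(P, θ)` onto the space of formal curvatures of `sp(P, θ)`, every formal curvature has
exactly one `n` as in `IsRepresentedByBivectorOfRank`, and `sInf` picks it. -/
def bivectorRank {P : Type*} [AddCommGroup P] [Module ℝ P]
    (θ : LinearMap.BilinForm ℝ P) (R : P → P → P → P) : ℕ :=
  sInf {n : ℕ | IsRepresentedByBivectorOfRank θ R n}

/-! ### Symmetric spaces -/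

/-- A symmetric space structure on a manifold `M`: a symmetry `s_p` for every point `p`, depending
smoothly on the point, with `s_p ∘ s_p = id`, with `p` an isolated fixed point of `s_p`, and with
`s_p ∘ s_q ∘ s_p = s_(s_p(q))`. -/
structure SymmetricSpaceStructure (E : Type*) [NormedAddCommGroup E] [NormedSpace ℝ E]
    (M : Type*) [TopologicalSpace M] [ChartedSpace E M] where
  /-- The symmetries `p ↦ s_p`. -/
  sym : M → M → M
  contMDiff_sym : ContMDiff (𝓘(ℝ, E).prod 𝓘(ℝ, E)) 𝓘(ℝ, E) ∞ (fun x : M × M => sym x.1 x.2)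
  sym_sym : ∀ p q : M, sym p (sym p q) = q
  sym_self : ∀ p : M, sym p p = p
  isolated : ∀ p : M, ∀ᶠ q in 𝓝 p, sym p q = q → q = p
  sym_conj : ∀ p q r : M, sym p (sym q (sym p r)) = sym (sym p q) r

namespace SymmetricSpaceStructure

variable {E : Type*} [NormedAddCommGroup E] [NormedSpace ℝ E]
  {M : Type*} [TopologicalSpace M] [ChartedSpace E M]

/-- The infinitesimal transvection at `o` in the direction `v ∈ T_o M`: the vector field
`q ↦ ½ d/dt s_(γ(t)) (s_o q)` at `t = 0`, for a curve `γ` with `γ(0) = o` and `γ'(0) = v`. It is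
the generator of the transvections along the geodesic through `o` with velocity `v`, its value at
`o` is `v`, and these vector fields form the summand `𝔭` of the Lie algebra `𝔤 = [𝔭, 𝔭] ⊕ 𝔭` of
the transvection group. (The derivative lies in the tangent space at `s_o (s_o q) = q`.) -/
def transvectionField (S : SymmetricSpaceStructure E M) (o : M) (v : TangentSpace 𝓘(ℝ, E) o)
    (q : M) : TangentSpace 𝓘(ℝ, E) q :=
  (1 / 2 : ℝ) • (show TangentSpace 𝓘(ℝ, E) q from
    mfderiv 𝓘(ℝ, E) 𝓘(ℝ, E) (fun p : M => S.sym p (S.sym o q)) o v)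

/-- The curvature `R(x, y) z = -[[x, y], z]` of the symmetric space at `o`, where `T_o M` is
identified with `𝔭` through the infinitesimal transvections. (Passing from the Lie algebra of the
transvection group to vector fields reverses the sign of a bracket, and so does not change a double
bracket.) -/
def curvature (S : SymmetricSpaceStructure E M) (o : M) (x y z : TangentSpace 𝓘(ℝ, E) o) :
    TangentSpace 𝓘(ℝ, E) o :=
  -VectorField.mlieBracket 𝓘(ℝ, E)
    (VectorField.mlieBracket 𝓘(ℝ, E) (S.transvectionField o x) (S.transvectionField o y))
    (S.transvectionField o z) o

/-- The symplectic curvature rank of a symmetric space with an invariant symplectic form, computed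
at the point `o`, where the form is `θ`. -/
def symplecticCurvatureRank (S : SymmetricSpaceStructure E M) (o : M)
    (θ : LinearMap.BilinForm ℝ (TangentSpace 𝓘(ℝ, E) o)) : ℕ :=
  bivectorRank θ (S.curvature o)

end SymmetricSpaceStructure

/-! ### Extrinsic symplectic immersions -/

/-- The differential `dφ_p : T_p M → V` of a map into a vector space. -/
def differential {E : Type*} [NormedAddCommGroup E] [NormedSpace ℝ E]
    {M : Type*} [TopologicalSpace M] [ChartedSpace E M]
    {V : Type*} [NormedAddCommGroup V] [NormedSpace ℝ V]
    (φ : M → V) (p : M) : TangentSpace 𝓘(ℝ, E) p →ₗ[ℝ] V :=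
  (mfderiv 𝓘(ℝ, E) 𝓘(ℝ, V) φ p : TangentSpace 𝓘(ℝ, E) p →ₗ[ℝ] TangentSpace 𝓘(ℝ, V) (φ p))

/-- The image `T_p = dφ_p(T_p M) ⊆ V` of the tangent space. -/
def tangentImage {E : Type*} [NormedAddCommGroup E] [NormedSpace ℝ E]
    {M : Type*} [TopologicalSpace M] [ChartedSpace E M]
    {V : Type*} [NormedAddCommGroup V] [NormedSpace ℝ V]
    (φ : M → V) (p : M) : Submodule ℝ V :=
  LinearMap.range (differential (E := E) φ p)

/-- The pullback `(φ^* Ω)_p` on `T_p M`. -/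
def pullbackForm {E : Type*} [NormedAddCommGroup E] [NormedSpace ℝ E]
    {M : Type*} [TopologicalSpace M] [ChartedSpace E M]
    {V : Type*} [NormedAddCommGroup V] [NormedSpace ℝ V]
    (φ : M → V) (Ω : LinearMap.BilinForm ℝ V) (p : M) :
    LinearMap.BilinForm ℝ (TangentSpace 𝓘(ℝ, E) p) :=
  Ω.comp (differential (E := E) φ p) (differential (E := E) φ p)

/-- An extrinsic symplectic immersion of the symmetric space `(M, S)` into the symplectic vector
space `(V, Ω)`: a smooth immersion `φ` such that `Ω` is non-degenerate on every
`T_p = dφ_p(T_p M)`, and such that `φ ∘ s_p` is `φ` followed by the reflection in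
`(T_p, φ(p))`, for every `p`. -/
structure IsExtrinsicSymplecticImmersion {E : Type*} [NormedAddCommGroup E] [NormedSpace ℝ E]
    {M : Type*} [TopologicalSpace M] [ChartedSpace E M] (S : SymmetricSpaceStructure E M)
    {V : Type*} [NormedAddCommGroup V] [NormedSpace ℝ V] [FiniteDimensional ℝ V]
    (Ω : LinearMap.BilinForm ℝ V) (φ : M → V) : Prop where
  symplectic : IsSymplecticForm Ω
  contMDiff : ContMDiff 𝓘(ℝ, E) 𝓘(ℝ, V) ∞ φ
  immersion : ∀ p : M, Function.Injective (differential (E := E) φ p)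
  nondegenerate : ∀ p : M, (Ω.restrict (tangentImage (E := E) φ p)).Nondegenerate
  reflection : ∀ p q : M,
    φ (S.sym p q) = symplecticReflection symplectic (nondegenerate p) (φ p) (φ q)

/-- A map into a vector space is full if its image lies in no proper affine subspace. -/
def IsFullMap {M V : Type*} [AddCommGroup V] [Module ℝ V] (φ : M → V) : Prop :=
  ∀ A : AffineSubspace ℝ V, (∀ p : M, φ p ∈ A) → A = ⊤

/-- The dimensions of the ambient spaces of the extrinsic symplectic immersions of the symplectic
symmetric space `(M, S, θ)`, i.e. of those extrinsic symplectic immersions `ψ` of the symmetric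
space `(M, S)` that satisfy `ψ^* Ω' = θ`. (The norm on the finite-dimensional space `V'` only
serves to make it a manifold.) -/
def ambientDimensions {E : Type u} [NormedAddCommGroup E] [NormedSpace ℝ E]
    {M : Type w} [TopologicalSpace M] [ChartedSpace E M] (S : SymmetricSpaceStructure E M)
    (θ : ∀ p : M, LinearMap.BilinForm ℝ (TangentSpace 𝓘(ℝ, E) p)) : Set ℕ :=
  {n : ℕ | ∃ (V' : Type v) (_ : NormedAddCommGroup V') (_ : NormedSpace ℝ V')
    (_ : FiniteDimensional ℝ V') (Ω' : LinearMap.BilinForm ℝ V') (ψ : M → V'),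
    IsExtrinsicSymplecticImmersion S Ω' ψ ∧ (∀ p : M, pullbackForm ψ Ω' p = θ p) ∧
    Module.finrank ℝ V' = n}

end

/-!
The reflections `σ_p` of `V` are affine, and for a full immersion they depend smoothly on `p`,
because `σ_p(φ(q)) = φ(s_p(q))` is smooth in `p` and the points `φ(q)` span `V` affinely
(`contMDiff_reflection`). So `φ` maps each infinitesimal transvection at `o` to the restriction of
an affine vector field `v ↦ L_x (v - φ(o)) + dφ_o x` (`differential_transvectionField`), where the
endomorphism `L_x ∈ sp(V, Ω)` exchanges `T_o` and its orthogonal complement `N_o`. Its restriction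
`T_o → N_o` is the second fundamental form in the direction `x`, and its restriction `N_o → T_o`
gives the shape operators. Brackets of vector fields on `M` become brackets of affine fields on `V`
(`differential_mlieBracket_of_related`), which yields the symmetry of the second fundamental form
and the Gauss equation `R(x, y) = -[L_x, L_y]` on `T_o` (`differential_curvature`).

A normal vector `ξ` at `o` with `L_x ξ = 0` for all `x` is zero if `φ` is full
(`eq_zero_of_transvectionLinear_eq_zero`): the tangent spaces near `o` are spanned by the values
`L_x (φ(q) - φ(o)) + dφ_o x`, all of which are orthogonal to `ξ`, so `ξ` is normal near `o`. The set
of points near which `ξ` is normal is therefore open and closed, and `φ` lies in a hyperplane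
`Ω(·, ξ) = const` if `ξ ≠ 0`. Hence the shape operators of a basis of `N_o` are linearly
independent, and the Gauss equation represents the curvature by a bivector of rank `dim N_o`, whose
matrix is the inverse Gram matrix of the basis (`isRepresentedByBivectorOfRank_of_gauss`). A
bivector is determined by its curvature (`IsRepresentedByBivectorOfRank.le`), so
`dim V = dim M + srk(M, ω)` for every full immersion (`finrank_eq_of_isFullMap`).

Finally, every extrinsic symplectic immersion reduces to a full one with the same form in the
symplectic reduction of the direction of its affine span (`exists_full_reduction`). This does not
raise the dimension of the ambient space, and it lowers it unless the immersion is full.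
-/

/-! ### The bivector of a formal curvature -/

/-- Of the four terms of the two symmetric products, two pairs agree after exchanging `i` and `j`, as
the matrix is skew-symmetric. -/
theorem sum_smul_symProduct_sub {P : Type*} [AddCommGroup P] [Module ℝ P]
    (θ : LinearMap.BilinForm ℝ P) {n : ℕ} {a : Matrix (Fin n) (Fin n) ℝ}
    (ha : a.transpose = -a) (A : Fin n → (P →ₗ[ℝ] P)) (x y z : P) :
    (1 / 2 : ℝ) • ∑ i, ∑ j, a i j •
      (symProduct θ (A i x) (A j y) z - symProduct θ (A i y) (A j x) z) =
    ∑ i, ∑ j, a i j • (θ (A j y) z • A i x - θ (A j x) z • A i y) := by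
  have hswap : ∀ i j, a j i = -a i j := fun i j => congrFun (congrFun ha i) j
  have h : ∑ i, ∑ j, a i j • (θ (A i x) z • A j y - θ (A i y) z • A j x) =
      ∑ i, ∑ j, a i j • (θ (A j y) z • A i x - θ (A j x) z • A i y) := by
    rw [Finset.sum_comm]
    refine Finset.sum_congr rfl fun i _ => Finset.sum_congr rfl fun j _ => ?_
    rw [hswap i j]
    module
  have h' : ∑ i, ∑ j, a i j •
      (symProduct θ (A i x) (A j y) z - symProduct θ (A i y) (A j x) z) =
      ∑ i, ∑ j, a i j • (θ (A i x) z • A j y - θ (A i y) z • A j x) +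
      ∑ i, ∑ j, a i j • (θ (A j y) z • A i x - θ (A j x) z • A i y) := by
    simp only [← Finset.sum_add_distrib]
    refine Finset.sum_congr rfl fun i _ => Finset.sum_congr rfl fun j _ => ?_
    simp only [symProduct, LinearMap.add_apply, LinearMap.smulRight_apply]
    module
  rw [h', h]
  module

/-- A quadrilinear form that is symmetric in each of the two pairs of arguments, changes sign when
the two pairs are exchanged, and has zero curvature, vanishes: it is totally symmetric. -/
theorem eq_zero_of_pairSymmetric {P : Type*} {F : P → P → P → P → ℝ}
    (h₁ : ∀ x w y z, F x w y z = F w x y z) (h₂ : ∀ x w y z, F x w y z = -F y z x w)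
    (h₃ : ∀ x w y z, F x w y z - F y w x z = 0) (x w y z : P) : F x w y z = 0 := by
  -- four transpositions, each of which preserves `F`, compose to the exchange of the two pairs
  have h₄ : ∀ x w y z, F x w y z = F x w z y := fun x w y z => by
    rw [h₂ x w y z, h₂ x w z y, h₁ y z]
  have e₁ : F x w y z = F y w x z := sub_eq_zero.1 (h₃ x w y z)
  have e₂ : F y w x z = F w y z x := by rw [h₁ y w, h₄]
  have e₃ : F w y z x = F z y w x := sub_eq_zero.1 (h₃ w y z x)
  have e₄ : F z y w x = F y z x w := by rw [h₁ z y, h₄]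
  have := h₂ x w y z
  linarith

/-- A bivector of `sp(P, θ)` is determined by its curvature, and so is its rank. -/
theorem IsRepresentedByBivectorOfRank.le {P : Type*} [AddCommGroup P] [Module ℝ P]
    {θ : LinearMap.BilinForm ℝ P} (hθ : IsSymplecticForm θ) {R : P → P → P → P} {n m : ℕ}
    (hn : IsRepresentedByBivectorOfRank θ R n) (hm : IsRepresentedByBivectorOfRank θ R m) :
    n ≤ m := by
  obtain ⟨a, A, ha, hdet, hA, hAs, hRA⟩ := hn
  obtain ⟨b, B, hb, -, -, hBs, hRB⟩ := hm
  have hsymm : ∀ C : P →ₗ[ℝ] P, IsInfinitesimallySymplectic θ C →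
      ∀ x y, θ (C x) y = θ (C y) x := fun C hC x y => by
    rw [← hθ.isAlt.neg_eq x (C y)]
    linarith [hC x y]
  have hRA' := fun x y z => (hRA x y z).trans (sum_smul_symProduct_sub θ ha A x y z)
  have hRB' := fun x y z => (hRB x y z).trans (sum_smul_symProduct_sub θ hb B x y z)
  -- the difference of the two bivectors as a quadrilinear form
  set D : P → P → (P →ₗ[ℝ] P) := fun y z =>
    ∑ i, ∑ j, (a i j * θ (A j y) z) • A i - ∑ i, ∑ j, (b i j * θ (B j y) z) • B i with hD
  have hF : ∀ x w y z, θ (D y z x) w =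
      ∑ i, ∑ j, a i j * θ (A j y) z * θ (A i x) w -
        ∑ i, ∑ j, b i j * θ (B j y) z * θ (B i x) w := fun x w y z => by
    simp [hD, LinearMap.sub_apply, LinearMap.sum_apply]
  have hpair : ∀ {k : ℕ} (c : Matrix (Fin k) (Fin k) ℝ) (C : Fin k → (P →ₗ[ℝ] P)),
      c.transpose = -c → ∀ x w y z, ∑ i, ∑ j, c i j * θ (C j y) z * θ (C i x) w =
        -∑ i, ∑ j, c i j * θ (C j x) w * θ (C i y) z := fun c C hc x w y z => by
    have hswap : ∀ i j, c j i = -c i j := fun i j => congrFun (congrFun hc i) j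
    rw [Finset.sum_comm, ← Finset.sum_neg_distrib]
    refine Finset.sum_congr rfl fun i _ => ?_
    rw [← Finset.sum_neg_distrib]
    refine Finset.sum_congr rfl fun j _ => ?_
    rw [hswap i j]
    ring
  have hzero : ∀ x w y z, θ (D y z x) w = 0 := by
    refine eq_zero_of_pairSymmetric (F := fun x w y z => θ (D y z x) w) ?_ ?_ ?_
    · intro x w y z
      simp only [hF]
      simp only [fun i => hsymm _ (hAs i) x w, fun i => hsymm _ (hBs i) x w]
    · intro x w y z
      simp only [hF]
      rw [hpair a A ha x w y z, hpair b B hb x w y z]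
      ring
    · intro x w y z
      have h := congrArg (fun t => θ t w) ((hRA' x y z).symm.trans (hRB' x y z))
      simp only [smul_sub, smul_smul, Finset.sum_sub_distrib, map_sub, map_sum, map_smul,
        LinearMap.sub_apply, LinearMap.sum_apply, LinearMap.smul_apply, smul_eq_mul] at h
      simp only [hF]
      linarith
  have hD0 : ∀ y z, D y z = 0 := fun y z =>
    LinearMap.ext fun x => hθ.nondegenerate.1 _ fun w => hzero x w y z
  -- the vectors `(θ (A j y) z)_j` span `ℝⁿ`, as the `A j` are linearly independent
  have hspan : Submodule.span ℝ (Set.range fun p : P × P => fun j => θ (A j p.1) p.2) =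
      (⊤ : Submodule ℝ (Fin n → ℝ)) := by
    by_contra hne
    obtain ⟨f, hf, hf0⟩ := Submodule.exists_le_ker_of_lt_top _ (lt_top_iff_ne_top.2 hne)
    apply hf
    have hfc : ∀ c : Fin n → ℝ, f c = ∑ j, f (Pi.single j 1) * c j := fun c => by
      conv_lhs => rw [pi_eq_sum_univ' c, map_sum]
      exact Finset.sum_congr rfl fun j _ => by rw [map_smul, smul_eq_mul, mul_comm]
    have hcomb : ∑ j, f (Pi.single j 1) • A j = 0 := by
      refine LinearMap.ext fun y => hθ.nondegenerate.1 _ fun z => ?_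
      have := hf0 (Submodule.subset_span ⟨(y, z), rfl⟩)
      rw [LinearMap.mem_ker, hfc] at this
      simpa [LinearMap.sum_apply] using this
    have := Fintype.linearIndependent_iff.1 hA _ hcomb
    ext c
    simp [this]
  have hmem : ∀ c : Fin n → ℝ, ∑ i, a.mulVec c i • A i ∈ Submodule.span ℝ (Set.range B) := by
    intro c
    have hc : c ∈ Submodule.span ℝ (Set.range fun p : P × P => fun j => θ (A j p.1) p.2) :=
      hspan ▸ Submodule.mem_top
    induction hc using Submodule.span_induction with
    | mem c hc =>
      obtain ⟨⟨y, z⟩, rfl⟩ := hc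
      have h := sub_eq_zero.1 (hD0 y z)
      simp only [← Finset.sum_smul] at h
      simp only [Matrix.mulVec, dotProduct]
      rw [h]
      exact Submodule.sum_mem _ fun i _ =>
        Submodule.smul_mem _ _ (Submodule.subset_span ⟨i, rfl⟩)
    | zero => simp
    | add c d _ _ hc hd =>
      simpa [Matrix.mulVec_add, add_smul, Finset.sum_add_distrib] using add_mem hc hd
    | smul t c _ hc =>
      simpa [Matrix.mulVec_smul, mul_smul, Finset.smul_sum] using Submodule.smul_mem _ t hc
  have hle : Submodule.span ℝ (Set.range A) ≤ Submodule.span ℝ (Set.range B) := by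
    rw [Submodule.span_le]
    rintro _ ⟨i, rfl⟩
    have := hmem (a⁻¹.mulVec (Pi.single i 1))
    rw [Matrix.mulVec_mulVec, Matrix.mul_nonsing_inv _ hdet, Matrix.one_mulVec] at this
    simpa [Pi.single_apply] using this
  calc n = Module.finrank ℝ (Submodule.span ℝ (Set.range A)) := by
        rw [finrank_span_eq_card hA, Fintype.card_fin]
    _ ≤ Module.finrank ℝ (Submodule.span ℝ (Set.range B)) :=
        haveI := FiniteDimensional.span_of_finite ℝ (Set.finite_range B)
        Submodule.finrank_mono hle
    _ ≤ m := (finrank_range_le_card (R := ℝ) B).trans_eq (Fintype.card_fin m)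

theorem IsRepresentedByBivectorOfRank.bivectorRank_eq {P : Type*} [AddCommGroup P] [Module ℝ P]
    {θ : LinearMap.BilinForm ℝ P} (hθ : IsSymplecticForm θ) {R : P → P → P → P} {n : ℕ}
    (hn : IsRepresentedByBivectorOfRank θ R n) : bivectorRank θ R = n :=
  le_antisymm (Nat.sInf_le hn) (hn.le hθ <|
    Nat.sInf_mem (s := {k | IsRepresentedByBivectorOfRank θ R k}) ⟨n, hn⟩)

/-! ### The Gauss equation -/

/-- The Gauss equation in algebraic form. Here `j : P → V` is the differential of an immersion at a
point and `L x` the derivative of the family of tangent spaces in the direction `x`: it exchanges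
the tangent space `range j` with the normal space, so that `L x (j y)` is the second fundamental
form and `ξ ↦ (x ↦ -L x ξ)` gives the shape operators. If these are injective in the normal vector
`ξ`, the curvature is represented by the bivector whose matrix is the inverse Gram matrix of a basis
of the normal space. -/
theorem isRepresentedByBivectorOfRank_of_gauss {P V : Type*} [AddCommGroup P] [Module ℝ P]
    [AddCommGroup V] [Module ℝ V] [FiniteDimensional ℝ V] {Ω : LinearMap.BilinForm ℝ V}
    (hΩ : IsSymplecticForm Ω) {j : P →ₗ[ℝ] V} (hj : Function.Injective j)
    (hT : (Ω.restrict (LinearMap.range j)).Nondegenerate) {L : P →ₗ[ℝ] V →ₗ[ℝ] V}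
    (hskew : ∀ x u v, Ω (L x u) v = -Ω u (L x v))
    (hnormal : ∀ x, ∀ ξ ∈ Ω.orthogonal (LinearMap.range j), L x ξ ∈ LinearMap.range j)
    (htangent : ∀ x y, L x (j y) ∈ Ω.orthogonal (LinearMap.range j))
    (hsymm : ∀ x y, L x (j y) = L y (j x))
    (hinj : ∀ ξ ∈ Ω.orthogonal (LinearMap.range j), (∀ x, L x ξ = 0) → ξ = 0)
    {R : P → P → P → P} (hR : ∀ x y z, j (R x y z) = L y (L x (j z)) - L x (L y (j z))) :
    IsRepresentedByBivectorOfRank (Ω.comp j j) R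
      (Module.finrank ℝ (Ω.orthogonal (LinearMap.range j))) := by
  set N := Ω.orthogonal (LinearMap.range j) with hN
  obtain ⟨G, hG⟩ := j.exists_leftInverse_of_injective (LinearMap.ker_eq_bot.2 hj)
  have hjG : ∀ t ∈ LinearMap.range j, j (G t) = t := by
    rintro _ ⟨x, rfl⟩
    rw [← LinearMap.comp_apply G, hG, LinearMap.id_apply]
  let shape : V →ₗ[ℝ] P →ₗ[ℝ] P := -(L.flip.compr₂ G)
  have hshape : ∀ ξ ∈ N, ∀ x, j (shape ξ x) = -L x ξ := fun ξ hξ x => by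
    simp [shape, hjG _ (hnormal x ξ hξ)]
  have halt : ∀ u v, Ω u v = -Ω v u := fun u v => (hΩ.isAlt.neg_eq v u).symm
  -- the defining relation between shape operators and second fundamental form
  have hrel : ∀ ξ ∈ N, ∀ x y, Ω (j (shape ξ x)) (j y) = Ω ξ (L x (j y)) := fun ξ hξ x y => by
    rw [hshape ξ hξ, map_neg, LinearMap.neg_apply, hskew, neg_neg]
  have hNnd : (Ω.restrict N).Nondegenerate := by
    refine Ω.nondegenerate_restrict_of_disjoint_orthogonal hΩ.isAlt.isRefl ?_
    rw [hN, LinearMap.BilinForm.orthogonal_orthogonal hΩ.nondegenerate hΩ.isAlt.isRefl]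
    exact (hΩ.isCompl hT).disjoint.symm
  let b := Module.finBasis ℝ N
  set g := LinearMap.BilinForm.toMatrix b (Ω.restrict N) with hg
  have hgdet : IsUnit g.det :=
    isUnit_iff_ne_zero.2 ((LinearMap.BilinForm.nondegenerate_iff_det_ne_zero b).1 hNnd)
  have hgij : ∀ i k, g i k = Ω (b i) (b k) := fun i k => by
    rw [hg, LinearMap.BilinForm.toMatrix_apply]; rfl
  have hgt : g.transpose = -g := by
    ext i k
    rw [Matrix.transpose_apply, Matrix.neg_apply, hgij, hgij, halt]
  have hginv : (g⁻¹).transpose = -g⁻¹ := by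
    rw [Matrix.transpose_nonsing_inv, hgt]
    refine Matrix.inv_eq_left_inv ?_
    rw [neg_mul_neg, Matrix.nonsing_inv_mul _ hgdet]
  -- expansion of a normal vector in the basis `b`
  have hexp : ∀ ξ ∈ N, ∑ i, ∑ k, (g⁻¹ i k * Ω (b k) ξ) • (b i : V) = ξ := fun ξ hξ => by
    have hsum : ∑ i, b.repr ⟨ξ, hξ⟩ i • (b i : V) = ξ :=
      (map_sum N.subtype _ _).symm.trans (congrArg N.subtype (b.sum_repr ⟨ξ, hξ⟩))
    have h₁ : (fun k => Ω (b k) ξ) = g.mulVec (b.repr ⟨ξ, hξ⟩) := by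
      ext k
      conv_lhs => rw [← hsum]
      simp [Matrix.mulVec, dotProduct, hgij, mul_comm]
    have h₂ : ∀ i, ∑ k, g⁻¹ i k * Ω (b k) ξ = b.repr ⟨ξ, hξ⟩ i := fun i => by
      have := congrFun (congrArg (g⁻¹).mulVec h₁) i
      rw [Matrix.mulVec_mulVec, Matrix.nonsing_inv_mul _ hgdet, Matrix.one_mulVec] at this
      exact this
    simp only [← Finset.sum_smul, h₂, hsum]
  refine ⟨g⁻¹, fun i => shape (b i), hginv, ?_, ?_, ?_, ?_⟩
  · exact Matrix.isUnit_nonsing_inv_det _ hgdet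
  · have hb : LinearIndependent ℝ (fun i => (b i : V)) :=
      b.linearIndependent.map' N.subtype N.ker_subtype
    refine Fintype.linearIndependent_iff.2 fun c hc => ?_
    refine Fintype.linearIndependent_iff.1 hb c (hinj _ ?_ fun x => ?_)
    · exact Submodule.sum_mem _ fun i _ => Submodule.smul_mem _ _ (b i).2
    · have hm : ∑ i, c i • (b i : V) ∈ N :=
        Submodule.sum_mem _ fun i _ => Submodule.smul_mem _ _ (b i).2
      have h := hshape _ hm x
      rw [map_sum] at h
      simp only [map_smul] at h
      rw [hc, LinearMap.zero_apply, map_zero] at h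
      simpa using h.symm
  · intro i x y
    simp only [LinearMap.BilinForm.comp_apply]
    rw [hrel _ (b i).2, halt (j x), hrel _ (b i).2, hsymm x y, add_neg_cancel]
  · intro x y z
    rw [sum_smul_symProduct_sub _ hginv]
    apply hj
    have hexp' : ∀ x y, L x (j y) =
        ∑ i, ∑ k, (g⁻¹ i k * Ω (j (shape (b k) x)) (j y)) • (b i : V) := fun x y => by
      conv_lhs => rw [← hexp _ (htangent x y)]
      simp only [hrel _ (b _).2]
    rw [hR, hexp' x z, hexp' y z]
    simp only [map_sum, map_smul, map_sub, LinearMap.BilinForm.comp_apply, hshape _ (b _).2,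
      ← Finset.sum_sub_distrib]
    refine Finset.sum_congr rfl fun i _ => Finset.sum_congr rfl fun k _ => ?_
    module

/-! ### Symplectic reflections -/

section Reflection

theorem IsSymplecticForm.eq_neg {V : Type*} [AddCommGroup V] [Module ℝ V]
    {Ω : LinearMap.BilinForm ℝ V} (hΩ : IsSymplecticForm Ω) (u v : V) : Ω u v = -Ω v u :=
  (hΩ.isAlt.neg_eq v u).symm

variable {V : Type*} [AddCommGroup V] [Module ℝ V] [FiniteDimensional ℝ V]
  {Ω : LinearMap.BilinForm ℝ V} (hΩ : IsSymplecticForm Ω) {W : Submodule ℝ V}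
  (hW : (Ω.restrict W).Nondegenerate)

theorem symplecticReflection_apply (p x : V) :
    symplecticReflection hΩ hW p x = symplecticReflectionLinear hΩ hW (x - p) + p := rfl

theorem symplecticReflectionLinear_of_mem {w : V} (hw : w ∈ W) :
    symplecticReflectionLinear hΩ hW w = -w :=
  symplecticReflection_linear_of_mem hΩ hW 0 hw

theorem symplecticReflectionLinear_of_mem_orthogonal {w : V} (hw : w ∈ Ω.orthogonal W) :
    symplecticReflectionLinear hΩ hW w = w :=
  symplecticReflection_linear_of_mem_orthogonal hΩ hW 0 hw

theorem exists_eq_add_mem_orthogonal {V : Type*} [AddCommGroup V] [Module ℝ V]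
    [FiniteDimensional ℝ V] {Ω : LinearMap.BilinForm ℝ V} (hΩ : IsSymplecticForm Ω)
    {W : Submodule ℝ V} (hW : (Ω.restrict W).Nondegenerate) (u : V) :
    ∃ t ∈ W, ∃ n ∈ Ω.orthogonal W, u = t + n := by
  obtain ⟨t, ht, n, hn, h⟩ := Submodule.mem_sup.1
    ((hΩ.isCompl hW).sup_eq_top.symm ▸ Submodule.mem_top : u ∈ W ⊔ Ω.orthogonal W)
  exact ⟨t, ht, n, hn, h.symm⟩

theorem symplecticReflectionLinear_involutive (u : V) :
    symplecticReflectionLinear hΩ hW (symplecticReflectionLinear hΩ hW u) = u := by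
  obtain ⟨t, ht, n, hn, rfl⟩ := exists_eq_add_mem_orthogonal hΩ hW u
  simp [map_add, symplecticReflectionLinear_of_mem hΩ hW ht,
    symplecticReflectionLinear_of_mem_orthogonal hΩ hW hn]

theorem symplecticReflectionLinear_eq_neg_iff {u : V} :
    symplecticReflectionLinear hΩ hW u = -u ↔ u ∈ W := by
  refine ⟨fun h => ?_, symplecticReflectionLinear_of_mem hΩ hW⟩
  obtain ⟨t, ht, n, hn, rfl⟩ := exists_eq_add_mem_orthogonal hΩ hW u
  rw [map_add, symplecticReflectionLinear_of_mem hΩ hW ht,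
    symplecticReflectionLinear_of_mem_orthogonal hΩ hW hn, neg_add, add_right_inj] at h
  have hn0 : n = 0 := by linear_combination (norm := module) (1 / 2 : ℝ) • h
  rw [hn0, add_zero]
  exact ht

theorem symplecticReflectionLinear_eq_self_iff {u : V} :
    symplecticReflectionLinear hΩ hW u = u ↔ u ∈ Ω.orthogonal W := by
  refine ⟨fun h => ?_, symplecticReflectionLinear_of_mem_orthogonal hΩ hW⟩
  obtain ⟨t, ht, n, hn, rfl⟩ := exists_eq_add_mem_orthogonal hΩ hW u
  rw [map_add, symplecticReflectionLinear_of_mem hΩ hW ht,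
    symplecticReflectionLinear_of_mem_orthogonal hΩ hW hn, add_left_inj] at h
  have ht0 : t = 0 := by linear_combination (norm := module) (-1 / 2 : ℝ) • h
  rw [ht0, zero_add]
  exact hn

theorem symplecticReflectionLinear_adjoint (u v : V) :
    Ω (symplecticReflectionLinear hΩ hW u) v = Ω u (symplecticReflectionLinear hΩ hW v) := by
  obtain ⟨t, ht, n, hn, rfl⟩ := exists_eq_add_mem_orthogonal hΩ hW u
  obtain ⟨t', ht', n', hn', rfl⟩ := exists_eq_add_mem_orthogonal hΩ hW v
  have h₁ : Ω t n' = 0 := hn' t ht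
  have h₂ : Ω n t' = 0 := by rw [hΩ.eq_neg, hn t' ht', neg_zero]
  simp [map_add, symplecticReflectionLinear_of_mem hΩ hW ht,
    symplecticReflectionLinear_of_mem_orthogonal hΩ hW hn,
    symplecticReflectionLinear_of_mem hΩ hW ht',
    symplecticReflectionLinear_of_mem_orthogonal hΩ hW hn', h₁, h₂]

end Reflection

/-! ### Vector fields related by an immersion -/

section Related

theorem ContinuousLinearMap.exists_leftInverse_of_finiteDimensional {E V : Type*}
    [NormedAddCommGroup E] [NormedSpace ℝ E] [NormedAddCommGroup V] [NormedSpace ℝ V]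
    [FiniteDimensional ℝ V] {j : E →L[ℝ] V}
    (hj : Function.Injective j) : ∃ G : V →L[ℝ] E, ∀ x, G (j x) = x := by
  obtain ⟨G, hG⟩ := (j : E →ₗ[ℝ] V).exists_leftInverse_of_injective (LinearMap.ker_eq_bot.2 hj)
  exact ⟨LinearMap.toContinuousLinearMap G, fun x => LinearMap.congr_fun hG x⟩

variable {E V : Type*} [NormedAddCommGroup E] [NormedSpace ℝ E] [FiniteDimensional ℝ E]
  [NormedAddCommGroup V] [NormedSpace ℝ V] [FiniteDimensional ℝ V]

/-- A vector field that an immersion maps to a differentiable field is differentiable. -/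
theorem DifferentiableAt.of_fderiv_apply_eq {f : E → V} {X : E → E} {B : V → V} {e : E}
    (hf : ContDiffAt ℝ 2 f e) (hinj : Function.Injective (fderiv ℝ f e))
    (hB : DifferentiableAt ℝ B (f e)) (h : ∀ᶠ y in 𝓝 e, fderiv ℝ f y (X y) = B (f y)) :
    DifferentiableAt ℝ X e := by
  have : CompleteSpace E := FiniteDimensional.complete ℝ E
  obtain ⟨G, hG⟩ := ContinuousLinearMap.exists_leftInverse_of_finiteDimensional hinj
  -- near `e` the field is recovered as `(G ∘ df)⁻¹ G B`
  set T : E → E →L[ℝ] E := fun y => G.comp (fderiv ℝ f y) with hT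
  have hTe : T e = 1 := ContinuousLinearMap.ext hG
  have hTd : DifferentiableAt ℝ T e :=
    (differentiableAt_const G).clm_comp
      ((hf.fderiv_right (m := 1) le_rfl).differentiableAt one_ne_zero)
  have hunit : IsUnit (T e) := hTe ▸ isUnit_one
  have hi : DifferentiableAt ℝ (fun y => Ring.inverse (T y) (G (B (f y)))) e :=
    DifferentiableAt.clm_apply ((differentiableAt_inverse hunit).comp e hTd)
      (G.differentiableAt.comp e (hB.comp e (hf.differentiableAt two_ne_zero)))
  refine hi.congr_of_eventuallyEq ?_
  filter_upwards [h, hTd.continuousAt.eventually (hunit.unit.nhds)] with y hy hu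
  have : T y (X y) = G (B (f y)) := by rw [hT, ContinuousLinearMap.comp_apply, hy]
  rw [← this, ← mul_apply_eq_comp, Ring.inverse_mul_cancel _ hu]
  rfl

theorem fderiv_lieBracket_of_related {f : E → V} {X Y : E → E} {B C : V → V} {e : E}
    (hf : ContDiffAt ℝ 2 f e) (hinj : Function.Injective (fderiv ℝ f e))
    (hB : DifferentiableAt ℝ B (f e)) (hC : DifferentiableAt ℝ C (f e))
    (hX : ∀ᶠ y in 𝓝 e, fderiv ℝ f y (X y) = B (f y))
    (hY : ∀ᶠ y in 𝓝 e, fderiv ℝ f y (Y y) = C (f y)) :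
    fderiv ℝ f e (VectorField.lieBracket ℝ X Y e) = VectorField.lieBracket ℝ B C (f e) := by
  have hf' : DifferentiableAt ℝ (fderiv ℝ f) e :=
    (hf.fderiv_right (m := 1) le_rfl).differentiableAt one_ne_zero
  have key : ∀ {X : E → E} {B : V → V}, DifferentiableAt ℝ B (f e) →
      (∀ᶠ y in 𝓝 e, fderiv ℝ f y (X y) = B (f y)) → ∀ h : E,
      fderiv ℝ f e (fderiv ℝ X e h) =
        fderiv ℝ B (f e) (fderiv ℝ f e h) - fderiv ℝ (fderiv ℝ f) e h (X e) := by
    intro X B hB hX h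
    have hXd := DifferentiableAt.of_fderiv_apply_eq hf hinj hB hX
    have h₁ := (hf'.hasFDerivAt.clm_apply hXd.hasFDerivAt)
    have h₂ := hB.hasFDerivAt.comp e (hf.differentiableAt two_ne_zero).hasFDerivAt
    have h₃ := congrArg (fun A => A h) (h₁.unique (h₂.congr_of_eventuallyEq hX))
    simp only [add_apply, ContinuousLinearMap.comp_apply,
      ContinuousLinearMap.flip_apply] at h₃
    rw [← h₃]
    abel
  have hs : IsSymmSndFDerivAt ℝ f e := hf.isSymmSndFDerivAt (by simp)
  rw [VectorField.lieBracket_eq, VectorField.lieBracket_eq]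
  simp only [map_sub]
  rw [key hC hY, key hB hX, hs (X e) (Y e), hX.self_of_nhds, hY.self_of_nhds]
  abel

end Related

section Manifold

variable {E : Type*} [NormedAddCommGroup E] [NormedSpace ℝ E]
  {M : Type*} [TopologicalSpace M] [ChartedSpace E M]
  {V : Type*} [NormedAddCommGroup V] [NormedSpace ℝ V]

/-- The differential at `p`, read in the chart at `p`. -/
theorem mfderiv_eq_fderiv_extChartAt {h : M → V} {p : M}
    (hh : MDifferentiableAt 𝓘(ℝ, E) 𝓘(ℝ, V) h p) :
    mfderiv 𝓘(ℝ, E) 𝓘(ℝ, V) h p =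
      fderiv ℝ (h ∘ (extChartAt 𝓘(ℝ, E) p).symm) (extChartAt 𝓘(ℝ, E) p p) := by
  have h₁ : mfderiv 𝓘(ℝ, E) 𝓘(ℝ, V) h p = fderivWithin ℝ
      (h ∘ (extChartAt 𝓘(ℝ, E) p).symm) Set.univ (extChartAt 𝓘(ℝ, E) p p) := by
    refine (if_pos hh).trans ?_
    simp only [writtenInExtChartAt, extChartAt_model_space_eq_id, PartialEquiv.refl_coe,
      Function.id_comp, modelWithCornersSelf_coe, Set.range_id]
    rfl
  exact h₁.trans (congrFun fderivWithin_univ _)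

theorem contDiffAt_comp_extChartAt_symm [IsManifold 𝓘(ℝ, E) ∞ M] {h : M → V}
    (hh : ContMDiff 𝓘(ℝ, E) 𝓘(ℝ, V) ∞ h) (p : M) {y : E}
    (hy : y ∈ (extChartAt 𝓘(ℝ, E) p).target) :
    ContDiffAt ℝ ∞ (h ∘ (extChartAt 𝓘(ℝ, E) p).symm) y := by
  rw [← contMDiffAt_iff_contDiffAt]
  refine hh.contMDiffAt.comp y ?_
  exact (contMDiffOn_extChartAt_symm p).contMDiffAt
    ((isOpen_extChartAt_target p).mem_nhds hy)

theorem fderiv_comp_extChartAt_symm_apply [IsManifold 𝓘(ℝ, E) ∞ M] {φ : M → V}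
    (hφ : ContMDiff 𝓘(ℝ, E) 𝓘(ℝ, V) ∞ φ) {q : M} {y : E}
    (hy : y ∈ (extChartAt 𝓘(ℝ, E) q).target) (w : E) :
    fderiv ℝ (φ ∘ (extChartAt 𝓘(ℝ, E) q).symm) y w =
      differential (E := E) φ ((extChartAt 𝓘(ℝ, E) q).symm y)
        (mfderiv 𝓘(ℝ, E) 𝓘(ℝ, E) (extChartAt 𝓘(ℝ, E) q).symm y w) := by
  have hcs : MDifferentiableAt 𝓘(ℝ, E) 𝓘(ℝ, E) (extChartAt 𝓘(ℝ, E) q).symm y :=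
    ((contMDiffOn_extChartAt_symm (n := ∞) q).contMDiffAt
      ((isOpen_extChartAt_target q).mem_nhds hy)).mdifferentiableAt (by simp)
  have h := mfderiv_comp y (hφ.contMDiffAt.mdifferentiableAt (by simp)) hcs
  rw [mfderiv_eq_fderiv] at h
  exact congrArg (fun A => A w) h

/-- The bracket of two vector fields that an immersion `φ` maps to fields `B` and `C` of the
ambient vector space is mapped to the bracket of `B` and `C`. -/
theorem differential_mlieBracket_of_related [FiniteDimensional ℝ E] [FiniteDimensional ℝ V]
    [IsManifold 𝓘(ℝ, E) ∞ M] {φ : M → V}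
    (hφ : ContMDiff 𝓘(ℝ, E) 𝓘(ℝ, V) ∞ φ)
    (hinj : ∀ p : M, Function.Injective (differential (E := E) φ p))
    {X Y : Π q : M, TangentSpace 𝓘(ℝ, E) q} {B C : V → V} (hB : Differentiable ℝ B)
    (hC : Differentiable ℝ C) (hX : ∀ q, differential (E := E) φ q (X q) = B (φ q))
    (hY : ∀ q, differential (E := E) φ q (Y q) = C (φ q)) (q : M) :
    differential (E := E) φ q (VectorField.mlieBracket 𝓘(ℝ, E) X Y q) =
      VectorField.lieBracket ℝ B C (φ q) := by
  have : IsManifold 𝓘(ℝ, E) 1 M := IsManifold.of_le (n := ∞) (by simp)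
  set c := extChartAt 𝓘(ℝ, E) q with hc
  have hq : c.symm (c q) = q := extChartAt_to_inv q
  have hmd : ∀ p, MDifferentiableAt 𝓘(ℝ, E) 𝓘(ℝ, V) φ p := fun p =>
    hφ.contMDiffAt.mdifferentiableAt (by simp)
  have hchain : ∀ y ∈ c.target, ∀ w : E, fderiv ℝ (φ ∘ c.symm) y w =
      differential (E := E) φ (c.symm y) (mfderiv 𝓘(ℝ, E) 𝓘(ℝ, E) c.symm y w) :=
    fun y hy w => fderiv_comp_extChartAt_symm_apply hφ hy w
  have hinv : ∀ y ∈ c.target, (mfderiv 𝓘(ℝ, E) 𝓘(ℝ, E) c.symm y).IsInvertible := by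
    intro y hy
    have := isInvertible_mfderivWithin_extChartAt_symm (I := 𝓘(ℝ, E)) (x := q) hy
    rwa [modelWithCornersSelf_coe, Set.range_id, mfderivWithin_univ] at this
  have hpull : ∀ {Z : Π q : M, TangentSpace 𝓘(ℝ, E) q} {D : V → V},
      (∀ q, differential (E := E) φ q (Z q) = D (φ q)) → ∀ᶠ y in 𝓝 (c q),
      fderiv ℝ (φ ∘ c.symm) y (VectorField.mpullbackWithin 𝓘(ℝ, E) 𝓘(ℝ, E) c.symm Z
        (Set.range 𝓘(ℝ, E)) y) = D ((φ ∘ c.symm) y) := by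
    intro Z D hZ
    filter_upwards [extChartAt_target_mem_nhds q] with y hy
    refine (hchain y hy _).trans ?_
    rw [VectorField.mpullbackWithin, modelWithCornersSelf_coe, Set.range_id, mfderivWithin_univ]
    refine Eq.trans ?_ (hZ (c.symm y))
    refine congrArg (differential (E := E) φ (c.symm y)) ?_
    obtain ⟨A, hA⟩ := hinv y hy
    rw [← hA, ContinuousLinearMap.inverse_equiv]
    exact A.apply_symm_apply _
  have hf := contDiffAt_comp_extChartAt_symm hφ q (mem_extChartAt_target q)
  have hd : ∀ w : E, fderiv ℝ (φ ∘ c.symm) (c q) w = differential (E := E) φ q w := fun w =>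
    (congrArg (fun A : E →L[ℝ] V => A w) (mfderiv_eq_fderiv_extChartAt (hmd q))).symm
  have key := fderiv_lieBracket_of_related (hf.of_le ENat.LEInfty.out)
    (fun a b hab => hinj q ((hd a).symm.trans (hab.trans (hd b)))) hB.differentiableAt
    hC.differentiableAt (hpull hX) (hpull hY)
  -- the differential of the chart at its base point is the identity
  have hid : (mfderiv 𝓘(ℝ, E) 𝓘(ℝ, E) c q : E →L[ℝ] E) = ContinuousLinearMap.id ℝ E := by
    have h₁ := mfderiv_chartAt_eq_tangentCoordChange (I := 𝓘(ℝ, E)) (x := q)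
      (mem_chart_source E q)
    ext w
    exact (congrArg (fun A : E →L[ℝ] E => A w) h₁).trans
      (tangentCoordChange_self (I := 𝓘(ℝ, E)) (mem_extChartAt_source q))
  have hbr : (VectorField.mlieBracket 𝓘(ℝ, E) X Y q : E) = VectorField.lieBracket ℝ
      (VectorField.mpullbackWithin 𝓘(ℝ, E) 𝓘(ℝ, E) c.symm X (Set.range 𝓘(ℝ, E)))
      (VectorField.mpullbackWithin 𝓘(ℝ, E) 𝓘(ℝ, E) c.symm Y (Set.range 𝓘(ℝ, E))) (c q) := by
    have h₁ : (mfderiv 𝓘(ℝ, E) 𝓘(ℝ, E) c q : E →L[ℝ] E).inverse = ContinuousLinearMap.id ℝ E :=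
      hid ▸ ContinuousLinearMap.inverse_id
    refine (congrArg (fun A : E →L[ℝ] E => A (VectorField.lieBracketWithin ℝ
      (VectorField.mpullbackWithin 𝓘(ℝ, E) 𝓘(ℝ, E) c.symm X (Set.range 𝓘(ℝ, E)))
      (VectorField.mpullbackWithin 𝓘(ℝ, E) 𝓘(ℝ, E) c.symm Y (Set.range 𝓘(ℝ, E)))
      (c.symm ⁻¹' Set.univ ∩ Set.range 𝓘(ℝ, E)) (c q))) h₁).trans ?_
    rw [modelWithCornersSelf_coe, Set.range_id, Set.preimage_univ, Set.univ_inter]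
    exact congrFun VectorField.lieBracketWithin_univ (c q)
  refine (congrArg (differential (E := E) φ q) hbr).trans ?_
  refine (hd _).symm.trans (key.trans ?_)
  rw [Function.comp_apply, hq]

end Manifold

/-! ### Infinitesimal transvections as affine vector fields -/

/-- The differential of a map into a vector space as a continuous linear map on the model space
`E`, to which `T_p M` is equal by definition. -/
noncomputable def modelDifferential {E : Type*} [NormedAddCommGroup E] [NormedSpace ℝ E]
    {M : Type*} [TopologicalSpace M] [ChartedSpace E M]
    {V : Type*} [NormedAddCommGroup V] [NormedSpace ℝ V] (φ : M → V) (p : M) : E →L[ℝ] V :=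
  mfderiv 𝓘(ℝ, E) 𝓘(ℝ, V) φ p

theorem modelDifferential_mem_tangentImage {E : Type*} [NormedAddCommGroup E] [NormedSpace ℝ E]
    {M : Type*} [TopologicalSpace M] [ChartedSpace E M]
    {V : Type*} [NormedAddCommGroup V] [NormedSpace ℝ V] (φ : M → V) (p : M) (x : E) :
    modelDifferential φ p x ∈ tangentImage (E := E) φ p :=
  ⟨x, rfl⟩

theorem ContMDiff.hasFDerivAt_comp_extChartAt_symm {E : Type*} [NormedAddCommGroup E]
    [NormedSpace ℝ E] {M : Type*} [TopologicalSpace M] [ChartedSpace E M]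
    [IsManifold 𝓘(ℝ, E) ∞ M] {V : Type*} [NormedAddCommGroup V] [NormedSpace ℝ V] {h : M → V}
    (hh : ContMDiff 𝓘(ℝ, E) 𝓘(ℝ, V) ∞ h) (o : M) :
    HasFDerivAt (h ∘ (extChartAt 𝓘(ℝ, E) o).symm) (modelDifferential h o)
      (extChartAt 𝓘(ℝ, E) o o) := by
  have h₁ : modelDifferential (E := E) h o = _ := mfderiv_eq_fderiv_extChartAt
    (hh.contMDiffAt.mdifferentiableAt (by simp))
  rw [h₁]
  exact ((contDiffAt_comp_extChartAt_symm hh o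
    (mem_extChartAt_target o)).differentiableAt (by simp)).hasFDerivAt

namespace IsExtrinsicSymplecticImmersion

variable {E : Type*} [NormedAddCommGroup E] [NormedSpace ℝ E]
  {M : Type*} [TopologicalSpace M] [ChartedSpace E M]
  {S : SymmetricSpaceStructure E M}
  {V : Type*} [NormedAddCommGroup V] [NormedSpace ℝ V] [FiniteDimensional ℝ V]
  {Ω : LinearMap.BilinForm ℝ V} {φ : M → V}

/-- The linear part of the reflection in `(T_p, φ(p))`. -/
noncomputable def reflectionLinear (hφ : IsExtrinsicSymplecticImmersion S Ω φ) (p : M) :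
    V →L[ℝ] V :=
  LinearMap.toContinuousLinearMap
    (symplecticReflectionLinear hφ.symplectic (hφ.nondegenerate p))

variable (hφ : IsExtrinsicSymplecticImmersion S Ω φ)

theorem reflectionLinear_involutive (p : M) (v : V) :
    hφ.reflectionLinear p (hφ.reflectionLinear p v) = v :=
  symplecticReflectionLinear_involutive hφ.symplectic (hφ.nondegenerate p) v

theorem reflectionLinear_eq_neg_iff {p : M} {v : V} :
    hφ.reflectionLinear p v = -v ↔ v ∈ tangentImage (E := E) φ p :=
  symplecticReflectionLinear_eq_neg_iff hφ.symplectic (hφ.nondegenerate p)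

theorem reflectionLinear_eq_self_iff {p : M} {v : V} :
    hφ.reflectionLinear p v = v ↔ v ∈ Ω.orthogonal (tangentImage (E := E) φ p) :=
  symplecticReflectionLinear_eq_self_iff hφ.symplectic (hφ.nondegenerate p)

theorem reflectionLinear_adjoint (p : M) (u v : V) :
    Ω (hφ.reflectionLinear p u) v = Ω u (hφ.reflectionLinear p v) :=
  symplecticReflectionLinear_adjoint hφ.symplectic (hφ.nondegenerate p) u v

theorem map_sym (p q : M) :
    φ (S.sym p q) = hφ.reflectionLinear p (φ q - φ p) + φ p :=
  hφ.reflection p q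

/-- If `φ` is full, then the reflections depend smoothly on the point: the vectors `v` for which
`p ↦ σ_p(v)` is smooth form an affine subspace, which contains the image of `φ` since
`σ_p(φ(q)) = φ(s_p(q))`. -/
theorem contMDiff_reflection (hfull : IsFullMap φ) (v : V) :
    ContMDiff 𝓘(ℝ, E) 𝓘(ℝ, V) ∞ (fun p => hφ.reflectionLinear p (v - φ p) + φ p) := by
  let A : AffineSubspace ℝ V :=
    { carrier := {v | ContMDiff 𝓘(ℝ, E) 𝓘(ℝ, V) ∞
        (fun p => hφ.reflectionLinear p (v - φ p) + φ p)}
      smul_vsub_vadd_mem' := by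
        intro t a b c ha hb hc
        have h := (contMDiff_const (I := 𝓘(ℝ, E)) (M := M) (I' := 𝓘(ℝ, ℝ)) (c := t)).smul
          (ha.sub hb) |>.add hc
        refine h.congr fun p => ?_
        simp only [vsub_eq_sub, vadd_eq_add, map_sub, map_add, map_smul, Pi.add_apply,
          Pi.smul_apply']
        module }
  have hA : A = ⊤ := hfull A fun q => by
    have : ContMDiff 𝓘(ℝ, E) 𝓘(ℝ, V) ∞ (fun p => φ (S.sym p q)) :=
      hφ.contMDiff.comp (S.contMDiff_sym.comp (contMDiff_id.prodMk contMDiff_const))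
    exact this.congr fun p => (hφ.map_sym p q).symm
  have : v ∈ A := hA ▸ AffineSubspace.mem_top ℝ V v
  exact this

theorem contMDiff_reflectionLinear_apply (hfull : IsFullMap φ) (v : V) :
    ContMDiff 𝓘(ℝ, E) 𝓘(ℝ, V) ∞ (fun p => hφ.reflectionLinear p v) := by
  refine ((hφ.contMDiff_reflection hfull v).sub (hφ.contMDiff_reflection hfull 0)).congr
    fun p => ?_
  simp only [map_sub, map_zero]
  abel

theorem differentiableAt_reflectionLinear_chart [IsManifold 𝓘(ℝ, E) ∞ M]
    (hfull : IsFullMap φ) (o : M) :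
    DifferentiableAt ℝ (fun e => hφ.reflectionLinear ((extChartAt 𝓘(ℝ, E) o).symm e))
      (extChartAt 𝓘(ℝ, E) o o) := by
  have h : ContDiffOn ℝ ∞ (fun e => hφ.reflectionLinear ((extChartAt 𝓘(ℝ, E) o).symm e))
      (extChartAt 𝓘(ℝ, E) o).target :=
    contDiffOn_clm_apply.2 fun v y hy => (contDiffAt_comp_extChartAt_symm
      (hφ.contMDiff_reflectionLinear_apply hfull v) o hy).contDiffWithinAt
  exact (h.contDiffAt (extChartAt_target_mem_nhds o)).differentiableAt (by simp)

/-- The derivative at `o` of the linear parts of the reflections. -/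
noncomputable def reflectionDeriv (o : M) : E →L[ℝ] V →L[ℝ] V :=
  fderiv ℝ (fun e => hφ.reflectionLinear ((extChartAt 𝓘(ℝ, E) o).symm e))
    (extChartAt 𝓘(ℝ, E) o o)

/-- The linear part of the affine vector field on `V` that generates the transvections along the
geodesic through `o` in the direction `x`. -/
noncomputable def transvectionLinear (o : M) : E →ₗ[ℝ] V →ₗ[ℝ] V :=
  LinearMap.mk₂ ℝ (fun x v => (1 / 2 : ℝ) • hφ.reflectionDeriv o x (hφ.reflectionLinear o v))
    (fun x y v => by simp [add_apply]) (fun t x v => by simp [smul_comm t])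
    (fun x u v => by simp) (fun t x v => by simp [smul_comm t])

theorem transvectionLinear_apply (o : M) (x : E) (v : V) : hφ.transvectionLinear o x v =
    (1 / 2 : ℝ) • hφ.reflectionDeriv o x (hφ.reflectionLinear o v) := rfl

variable [IsManifold 𝓘(ℝ, E) ∞ M]

theorem hasFDerivAt_reflectionLinear (hfull : IsFullMap φ) (o : M) :
    HasFDerivAt (fun e => hφ.reflectionLinear ((extChartAt 𝓘(ℝ, E) o).symm e))
      (hφ.reflectionDeriv o) (extChartAt 𝓘(ℝ, E) o o) :=
  (hφ.differentiableAt_reflectionLinear_chart hfull o).hasFDerivAt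

theorem reflectionDeriv_reflectionLinear (hfull : IsFullMap φ) (o : M) (x : E) (v : V) :
    hφ.reflectionDeriv o x (hφ.reflectionLinear o v) =
      -hφ.reflectionLinear o (hφ.reflectionDeriv o x v) := by
  have hS := hφ.hasFDerivAt_reflectionLinear hfull o
  have h := hS.clm_apply (hS.clm_apply (hasFDerivAt_const v _))
  simp only [reflectionLinear_involutive, extChartAt_to_inv] at h
  have h₀ := congrArg (fun A : E →L[ℝ] V => A x) (h.unique (hasFDerivAt_const v _))
  simp only [add_apply, ContinuousLinearMap.comp_apply, ContinuousLinearMap.flip_apply,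
    zero_apply, map_zero, zero_add] at h₀
  rw [eq_neg_iff_add_eq_zero, add_comm]
  exact h₀

theorem reflectionDeriv_adjoint (hfull : IsFullMap φ) (o : M) (x : E) (u v : V) :
    Ω (hφ.reflectionDeriv o x u) v = Ω u (hφ.reflectionDeriv o x v) := by
  have hS := hφ.hasFDerivAt_reflectionLinear hfull o
  have h₁ := (LinearMap.toContinuousLinearMap (Ω.flip v)).hasFDerivAt.comp _
    (hS.clm_apply (hasFDerivAt_const u _))
  have h₂ := (LinearMap.toContinuousLinearMap (Ω u)).hasFDerivAt.comp _
    (hS.clm_apply (hasFDerivAt_const v _))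
  have h := congrArg (fun A : E →L[ℝ] ℝ => A x) (h₁.unique (h₂.congr_of_eventuallyEq
    (Filter.Eventually.of_forall fun e => hφ.reflectionLinear_adjoint _ u v)))
  simpa using h

theorem transvectionLinear_skew (hfull : IsFullMap φ) (o : M) (x : E) (u v : V) :
    Ω (hφ.transvectionLinear o x u) v = -Ω u (hφ.transvectionLinear o x v) := by
  simp only [transvectionLinear_apply, map_smul, LinearMap.smul_apply]
  rw [hφ.reflectionDeriv_adjoint hfull, hφ.reflectionLinear_adjoint,
    hφ.reflectionDeriv_reflectionLinear hfull, map_neg]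
  simp

theorem reflectionLinear_transvectionLinear (hfull : IsFullMap φ) (o : M) (x : E) (v : V) :
    hφ.reflectionLinear o (hφ.transvectionLinear o x v) =
      -hφ.transvectionLinear o x (hφ.reflectionLinear o v) := by
  simp only [transvectionLinear_apply, map_smul, reflectionLinear_involutive]
  rw [hφ.reflectionDeriv_reflectionLinear hfull, map_neg, reflectionLinear_involutive, smul_neg]

theorem transvectionLinear_mem_orthogonal (hfull : IsFullMap φ) (o : M) (x : E) {v : V}
    (hv : v ∈ tangentImage (E := E) φ o) :
    hφ.transvectionLinear o x v ∈ Ω.orthogonal (tangentImage (E := E) φ o) := by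
  rw [← hφ.reflectionLinear_eq_self_iff, hφ.reflectionLinear_transvectionLinear hfull,
    hφ.reflectionLinear_eq_neg_iff.2 hv, map_neg, neg_neg]

theorem transvectionLinear_mem_tangentImage (hfull : IsFullMap φ) (o : M) (x : E) {v : V}
    (hv : v ∈ Ω.orthogonal (tangentImage (E := E) φ o)) :
    hφ.transvectionLinear o x v ∈ tangentImage (E := E) φ o := by
  rw [← hφ.reflectionLinear_eq_neg_iff, hφ.reflectionLinear_transvectionLinear hfull,
    hφ.reflectionLinear_eq_self_iff.2 hv]

theorem modelDifferential_comp_sym (hfull : IsFullMap φ) (o : M) (x : E) (r : M) :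
    modelDifferential (fun p => φ (S.sym p r)) o x =
      hφ.reflectionDeriv o x (φ r - φ o) + (2 : ℝ) • modelDifferential φ o x := by
  have h₁ : ContMDiff 𝓘(ℝ, E) 𝓘(ℝ, V) ∞ (fun p => φ (S.sym p r)) :=
    hφ.contMDiff.comp (S.contMDiff_sym.comp (contMDiff_id.prodMk contMDiff_const))
  have hf := hφ.contMDiff.hasFDerivAt_comp_extChartAt_symm o
  have h₂ := ((hφ.hasFDerivAt_reflectionLinear hfull o).clm_apply (hf.const_sub (φ r))).add hf
  rw [(h₁.hasFDerivAt_comp_extChartAt_symm o).unique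
    (h₂.congr_of_eventuallyEq (Filter.Eventually.of_forall fun e => hφ.map_sym _ r))]
  have ht := hφ.reflectionLinear_eq_neg_iff.2 (modelDifferential_mem_tangentImage φ o x)
  simp only [add_apply, ContinuousLinearMap.comp_apply, ContinuousLinearMap.flip_apply,
    neg_apply, Function.comp_apply, extChartAt_to_inv, map_neg, ht]
  module

/-- `φ` maps the infinitesimal transvection at `o` in the direction `x` to the restriction of an
affine vector field. -/
theorem differential_transvectionField (hfull : IsFullMap φ) (o : M) (x : E) (q : M) :
    differential (E := E) φ q (S.transvectionField o x q) =
      hφ.transvectionLinear o x (φ q - φ o) + modelDifferential φ o x := by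
  let D : M → E →L[ℝ] E := fun r => mfderiv 𝓘(ℝ, E) 𝓘(ℝ, E) (fun p => S.sym p r) o
  have hchain : ∀ r q : M, S.sym o r = q → modelDifferential φ q (D r x) =
      modelDifferential (fun p => φ (S.sym p r)) o x := by
    rintro r _ rfl
    have hs : MDifferentiableAt 𝓘(ℝ, E) 𝓘(ℝ, E) (fun p => S.sym p r) o :=
      (S.contMDiff_sym.comp
        (contMDiff_id.prodMk contMDiff_const)).contMDiffAt.mdifferentiableAt (by simp)
    exact (congrArg (fun A : E →L[ℝ] V => A x) (mfderiv_comp o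
      (hφ.contMDiff.contMDiffAt.mdifferentiableAt (by simp)) hs)).symm
  have hsq : φ (S.sym o q) - φ o = hφ.reflectionLinear o (φ q - φ o) := by
    rw [hφ.map_sym, add_sub_cancel_right]
  have hfin : differential (E := E) φ q (S.transvectionField o x q) =
      (1 / 2 : ℝ) • modelDifferential φ q (D (S.sym o q) x) :=
    (modelDifferential (E := E) φ q).map_smul (1 / 2 : ℝ) (D (S.sym o q) x)
  rw [hfin, hchain _ _ (S.sym_sym o q), hφ.modelDifferential_comp_sym hfull, hsq,
    transvectionLinear_apply]
  module

end IsExtrinsicSymplecticImmersion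

/-! ### Curvature and second fundamental form of a full immersion -/

namespace IsExtrinsicSymplecticImmersion

variable {E : Type*} [NormedAddCommGroup E] [NormedSpace ℝ E] [FiniteDimensional ℝ E]
  {M : Type*} [TopologicalSpace M] [ChartedSpace E M] [IsManifold 𝓘(ℝ, E) ∞ M]
  {S : SymmetricSpaceStructure E M}
  {V : Type*} [NormedAddCommGroup V] [NormedSpace ℝ V] [FiniteDimensional ℝ V]
  {Ω : LinearMap.BilinForm ℝ V} {φ : M → V} (hφ : IsExtrinsicSymplecticImmersion S Ω φ)

theorem hasFDerivAt_affineField (A : V →ₗ[ℝ] V) (c b v : V) :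
    HasFDerivAt (fun v => A (v - c) + b) (LinearMap.toContinuousLinearMap A) v :=
  ((LinearMap.toContinuousLinearMap A).hasFDerivAt.comp v
    ((hasFDerivAt_id v).sub_const c)).add_const b

/-- The bracket of the infinitesimal transvections at `o` in the directions `x` and `y`. -/
theorem differential_mlieBracket_transvectionField (hfull : IsFullMap φ) (o : M) (x y : E)
    (q : M) :
    differential (E := E) φ q (VectorField.mlieBracket 𝓘(ℝ, E) (S.transvectionField o x)
      (S.transvectionField o y) q) =
      (hφ.transvectionLinear o y ∘ₗ hφ.transvectionLinear o x -
        hφ.transvectionLinear o x ∘ₗ hφ.transvectionLinear o y) (φ q - φ o) +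
      (hφ.transvectionLinear o y (modelDifferential φ o x) -
        hφ.transvectionLinear o x (modelDifferential φ o y)) := by
  have h := fun x : E => hasFDerivAt_affineField (hφ.transvectionLinear o x) (φ o)
    (modelDifferential φ o x)
  have key := differential_mlieBracket_of_related hφ.contMDiff hφ.immersion
    (fun v => (h x v).differentiableAt) (fun v => (h y v).differentiableAt)
    (hφ.differential_transvectionField hfull o x) (hφ.differential_transvectionField hfull o y) q
  rw [VectorField.lieBracket_eq] at key
  simp only [(h x _).fderiv, (h y _).fderiv] at key
  rw [key]
  simp only [LinearMap.coe_toContinuousLinearMap', map_add, LinearMap.sub_apply,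
    LinearMap.comp_apply]
  abel

/-- The second fundamental form is symmetric: its skew-symmetric part is the bracket of two
infinitesimal transvections at `o`, which is tangent, while the form has normal values. -/
theorem transvectionLinear_symm (hfull : IsFullMap φ) (o : M) (x y : E) :
    hφ.transvectionLinear o x (modelDifferential φ o y) =
      hφ.transvectionLinear o y (modelDifferential φ o x) := by
  have h := hφ.differential_mlieBracket_transvectionField hfull o x y o
  rw [sub_self, map_zero, zero_add] at h
  have ht : hφ.transvectionLinear o y (modelDifferential φ o x) -
      hφ.transvectionLinear o x (modelDifferential φ o y) ∈ tangentImage (E := E) φ o :=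
    h ▸ LinearMap.mem_range_self _ _
  have hn := fun x y => hφ.transvectionLinear_mem_orthogonal hfull o x
    (modelDifferential_mem_tangentImage φ o y)
  exact (sub_eq_zero.1 (Submodule.disjoint_def.1
    (hφ.symplectic.isCompl (hφ.nondegenerate o)).disjoint _ ht (sub_mem (hn y x) (hn x y)))).symm

/-- The Gauss equation `R(x, y) = -[L_x, L_y]` on `T_o`. The bracket of the infinitesimal
transvections in the directions `x` and `y` vanishes at `o`, so that only its linear part
contributes to the double bracket. -/
theorem differential_curvature (hfull : IsFullMap φ) (o : M) (x y z : E) :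
    differential (E := E) φ o (S.curvature o x y z) =
      hφ.transvectionLinear o y (hφ.transvectionLinear o x (modelDifferential φ o z)) -
        hφ.transvectionLinear o x (hφ.transvectionLinear o y (modelDifferential φ o z)) := by
  have hx := hφ.differential_mlieBracket_transvectionField hfull o x y
  rw [hφ.transvectionLinear_symm hfull o x y, sub_self] at hx
  have h := hasFDerivAt_affineField (V := V)
  have key := differential_mlieBracket_of_related hφ.contMDiff hφ.immersion
    (fun v => (h _ _ _ v).differentiableAt) (fun v => (h _ _ _ v).differentiableAt)
    hx (hφ.differential_transvectionField hfull o z) o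
  rw [VectorField.lieBracket_eq] at key
  simp only [(h _ _ _ _).fderiv] at key
  have hneg : differential (E := E) φ o (S.curvature o x y z) = -_ :=
    (map_neg (differential (E := E) φ o) _).trans (congrArg Neg.neg key)
  rw [hneg]
  simp

/-- A normal vector annihilated by the second fundamental form at `o` stays normal near `o`. The
tangent spaces near `o` are spanned by the infinitesimal transvections at `o`, which are of the
form `L_x (φ(q) - φ(o)) + dφ_o x`. -/
theorem eventually_reflectionLinear_eq_self (hfull : IsFullMap φ) (o : M) {ξ : V}
    (hξ : hφ.reflectionLinear o ξ = ξ) (hL : ∀ x, hφ.transvectionLinear o x ξ = 0) :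
    ∀ᶠ q in 𝓝 o, hφ.reflectionLinear q ξ = ξ := by
  have hEc : CompleteSpace E := FiniteDimensional.complete ℝ E
  have hinj : Function.Injective (modelDifferential (E := E) φ o) := hφ.immersion o
  obtain ⟨G, hG⟩ := ContinuousLinearMap.exists_leftInverse_of_finiteDimensional hinj
  -- the operator `x ↦ G (L_x (φ(q) - φ(o)) + dφ_o x)`, which is the identity at `q = o`
  let T : M → E →L[ℝ] E := fun q => LinearMap.toContinuousLinearMap
    ((G : V →ₗ[ℝ] E) ∘ₗ (hφ.transvectionLinear o).flip (φ q - φ o)) + 1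
  have hTo : T o = 1 := by
    ext x
    simp [T]
  have hTc : Continuous T := by
    let K : V →ₗ[ℝ] E →L[ℝ] E := (LinearMap.toContinuousLinearMap :
      (E →ₗ[ℝ] E) ≃ₗ[ℝ] (E →L[ℝ] E)).toLinearMap ∘ₗ
        (hφ.transvectionLinear o).flip.compr₂ (G : V →ₗ[ℝ] E)
    exact ((LinearMap.continuous_of_finiteDimensional K).comp
      (hφ.contMDiff.continuous.sub continuous_const)).add continuous_const
  have hunit : ∀ᶠ q in 𝓝 o, IsUnit (T q) :=
    hTc.continuousAt.eventually (hTo ▸ (1 : (E →L[ℝ] E)ˣ).nhds)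
  filter_upwards [hunit] with q hq
  rw [hφ.reflectionLinear_eq_self_iff]
  let J : E →ₗ[ℝ] V := (hφ.transvectionLinear o).flip (φ q - φ o) +
    (modelDifferential (E := E) φ o : E →ₗ[ℝ] V)
  have hJ : ∀ x, J x = hφ.transvectionLinear o x (φ q - φ o) + modelDifferential φ o x :=
    fun x => rfl
  have hGJ : ∀ x, G (J x) = T q x := fun x => by
    rw [hJ, map_add, hG]; rfl
  have hJinj : Function.Injective J := fun a b hab => by
    obtain ⟨u, hu⟩ := hq
    have h₁ : (u : E →L[ℝ] E) a = (u : E →L[ℝ] E) b := by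
      rw [hu, ← hGJ, ← hGJ, hab]
    have h₂ := congrArg (fun t => (↑u⁻¹ : E →L[ℝ] E) t) h₁
    simpa only [← mul_apply_eq_comp, Units.inv_mul, one_apply_eq_self] using h₂
  have hrange : LinearMap.range J = tangentImage (E := E) φ q := by
    refine Submodule.eq_of_le_of_finrank_le ?_ ?_
    · rintro _ ⟨x, rfl⟩
      rw [hJ, ← hφ.differential_transvectionField hfull o x q]
      exact LinearMap.mem_range_self _ _
    · rw [LinearMap.finrank_range_of_inj hJinj]
      exact (LinearMap.finrank_range_le (modelDifferential (E := E) φ q : E →ₗ[ℝ] V))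
  rw [← hrange]
  rintro _ ⟨x, rfl⟩
  have hn := (hφ.reflectionLinear_eq_self_iff.1 hξ) _ (modelDifferential_mem_tangentImage φ o x)
  change Ω (J x) ξ = 0
  change Ω _ ξ = 0 at hn
  rw [hJ, map_add, LinearMap.add_apply, hn, hφ.transvectionLinear_skew hfull, hL, map_zero,
    neg_zero, add_zero]

theorem reflectionLinear_eq_self_of_eventually [ConnectedSpace M] (hfull : IsFullMap φ) {o : M}
    {ξ : V} (hξ : ∀ᶠ q in 𝓝 o, hφ.reflectionLinear q ξ = ξ) (q : M) :
    hφ.reflectionLinear q ξ = ξ := by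
  set Z : Set M := {p | ∀ᶠ q in 𝓝 p, hφ.reflectionLinear q ξ = ξ} with hZ
  have hsmooth := hφ.contMDiff_reflectionLinear_apply hfull ξ
  have hopen : IsOpen Z := by
    rw [isOpen_iff_mem_nhds]
    exact fun p hp => eventually_eventually_nhds.2 hp
  have hclosed : IsClosed Z := by
    refine isClosed_of_closure_subset fun p hp => ?_
    have hself : hφ.reflectionLinear p ξ = ξ := by
      have : IsClosed {q | hφ.reflectionLinear q ξ = ξ} :=
        isClosed_eq hsmooth.continuous continuous_const
      exact this.closure_subset_iff.2 (fun q hq => hq.self_of_nhds) hp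
    -- the derivative of `q ↦ S_q ξ` vanishes on `Z`, hence at `p` by continuity
    set c := extChartAt 𝓘(ℝ, E) p with hc
    set h : E → V := (fun q => hφ.reflectionLinear q ξ) ∘ c.symm with hh
    have hderiv : fderiv ℝ h (c p) = 0 := by
      have hcont : ContinuousAt (fderiv ℝ h) (c p) :=
        ((contDiffAt_comp_extChartAt_symm hsmooth p (mem_extChartAt_target p)).fderiv_right
          (m := 0) (by simp)).continuousAt
      have hfreq : ∃ᶠ q in 𝓝 p, fderiv ℝ h (c q) = 0 := by
        refine ((mem_closure_iff_frequently.1 hp).and_eventually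
          (extChartAt_source_mem_nhds (I := 𝓘(ℝ, E)) p)).mono fun q hq => ?_
        have hq' : ContinuousAt c.symm (c q) := continuousAt_extChartAt_symm' hq.2
        rw [← c.left_inv hq.2] at hq
        have hev : h =ᶠ[𝓝 (c q)] fun _ => ξ := hq'.eventually hq.1
        rw [hev.fderiv_eq, fderiv_const_apply]
      have hcont' : ContinuousAt (fun q => fderiv ℝ h (c q)) p :=
        ContinuousAt.comp (g := fderiv ℝ h) hcont (continuousAt_extChartAt p)
      by_contra hne
      exact hfreq (hcont'.eventually (isOpen_ne.mem_nhds hne))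
    refine hφ.eventually_reflectionLinear_eq_self hfull p hself fun x => ?_
    have h₁ := (hφ.hasFDerivAt_reflectionLinear hfull p).clm_apply (hasFDerivAt_const ξ _)
    have h₂ := congrArg (fun A : E →L[ℝ] V => A x) (h₁.fderiv.symm.trans hderiv)
    simp only [add_apply, ContinuousLinearMap.comp_apply, ContinuousLinearMap.flip_apply,
      zero_apply, map_zero, zero_add] at h₂
    rw [transvectionLinear_apply, hself, h₂, smul_zero]
  have huniv : Z = Set.univ := IsClopen.eq_univ ⟨hclosed, hopen⟩ ⟨o, hξ⟩
  exact (huniv ▸ Set.mem_univ q : q ∈ Z).self_of_nhds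

/-- The second fundamental form of a full immersion spans the normal space: a normal vector that it
annihilates is normal everywhere, so that `φ` lies in a hyperplane unless the vector is zero. -/
theorem eq_zero_of_transvectionLinear_eq_zero [ConnectedSpace M] (hfull : IsFullMap φ) (o : M)
    {ξ : V} (hξ : ξ ∈ Ω.orthogonal (tangentImage (E := E) φ o))
    (hL : ∀ x, hφ.transvectionLinear o x ξ = 0) : ξ = 0 := by
  have hself := hφ.reflectionLinear_eq_self_of_eventually hfull
    (hφ.eventually_reflectionLinear_eq_self hfull o (hφ.reflectionLinear_eq_self_iff.2 hξ) hL)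
  set l : V →L[ℝ] ℝ := LinearMap.toContinuousLinearMap (Ω.flip ξ) with hl
  have hlc : IsLocallyConstant (fun q => l (φ q)) := by
    rw [IsLocallyConstant.iff_eventually_eq]
    intro p
    set c := extChartAt 𝓘(ℝ, E) p with hc
    obtain ⟨r, hr, hball⟩ := Metric.isOpen_iff.1 (isOpen_extChartAt_target (I := 𝓘(ℝ, E)) p)
      (c p) (mem_extChartAt_target p)
    have hd : ∀ y ∈ Metric.ball (c p) r,
        HasFDerivAt (fun y => l (φ (c.symm y))) (0 : E →L[ℝ] ℝ) y := by
      intro y hy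
      have h₁ := l.hasFDerivAt.comp y ((contDiffAt_comp_extChartAt_symm hφ.contMDiff p
        (hball hy)).differentiableAt (by simp)).hasFDerivAt
      refine h₁.congr_fderiv (ContinuousLinearMap.ext fun w => ?_)
      rw [ContinuousLinearMap.comp_apply, fderiv_comp_extChartAt_symm_apply hφ.contMDiff
        (hball hy) w]
      exact hφ.reflectionLinear_eq_self_iff.1 (hself _) _ (LinearMap.mem_range_self _ _)
    filter_upwards [(continuousAt_extChartAt (I := 𝓘(ℝ, E)) p).eventually
      (Metric.ball_mem_nhds (c p) hr), extChartAt_source_mem_nhds (I := 𝓘(ℝ, E)) p] with q hq hqs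
    have h : l (φ (c.symm (c q))) = l (φ (c.symm (c p))) :=
      (convex_ball (c p) r).is_const_of_fderivWithin_eq_zero (𝕜 := ℝ)
        (f := fun y => l (φ (c.symm y)))
        (fun y hy => (hd y hy).differentiableAt.differentiableWithinAt)
        (fun y hy => by
          rw [fderivWithin_of_isOpen Metric.isOpen_ball hy, (hd y hy).fderiv]) hq
        (Metric.mem_ball_self hr)
    rwa [c.left_inv hqs, c.left_inv (mem_extChartAt_source p)] at h
  have hconst : ∀ q, Ω (φ q) ξ = Ω (φ o) ξ := fun q => hlc.apply_eq_of_isPreconnected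
    isPreconnected_univ (Set.mem_univ q) (Set.mem_univ o)
  have hA := hfull (AffineSubspace.mk' (φ o) (LinearMap.ker (Ω.flip ξ))) fun q => by
    rw [AffineSubspace.mem_mk', vsub_eq_sub, LinearMap.mem_ker, map_sub, sub_eq_zero]
    exact hconst q
  refine hφ.symplectic.nondegenerate.2 ξ fun v => ?_
  have hv : v + φ o ∈ AffineSubspace.mk' (φ o) (LinearMap.ker (Ω.flip ξ)) :=
    hA ▸ AffineSubspace.mem_top ℝ V _
  rw [AffineSubspace.mem_mk', vsub_eq_sub, add_sub_cancel_right] at hv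
  exact hv

theorem isSymplecticForm_pullbackForm {E : Type*} [NormedAddCommGroup E] [NormedSpace ℝ E]
    {M : Type*} [TopologicalSpace M] [ChartedSpace E M] {S : SymmetricSpaceStructure E M}
    {V : Type*} [NormedAddCommGroup V] [NormedSpace ℝ V] [FiniteDimensional ℝ V]
    {Ω : LinearMap.BilinForm ℝ V} {φ : M → V} (hφ : IsExtrinsicSymplecticImmersion S Ω φ) (o : M) :
    IsSymplecticForm (pullbackForm (E := E) φ Ω o) where
  isAlt x := hφ.symplectic.isAlt _
  nondegenerate := by
    refine ⟨fun x hx => ?_, fun x hx => ?_⟩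
    · refine (map_eq_zero_iff _ (hφ.immersion o)).1 (congrArg Subtype.val
        ((hφ.nondegenerate o).1 ⟨differential (E := E) φ o x, LinearMap.mem_range_self _ x⟩ ?_))
      rintro ⟨_, y, rfl⟩
      exact hx y
    · refine (map_eq_zero_iff _ (hφ.immersion o)).1 (congrArg Subtype.val
        ((hφ.nondegenerate o).2 ⟨differential (E := E) φ o x, LinearMap.mem_range_self _ x⟩ ?_))
      rintro ⟨_, y, rfl⟩
      exact hx y

/-- The normal space of a full immersion has dimension `srk(M, ω)`. -/
theorem finrank_eq_of_isFullMap [ConnectedSpace M]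
    (hφ : IsExtrinsicSymplecticImmersion S Ω φ) (hfull : IsFullMap φ) (o : M) :
    Module.finrank ℝ V = Module.finrank ℝ E +
      S.symplecticCurvatureRank o (pullbackForm φ Ω o) := by
  have hrep : IsRepresentedByBivectorOfRank (pullbackForm (E := E) φ Ω o) (S.curvature o)
      (Module.finrank ℝ (Ω.orthogonal (tangentImage (E := E) φ o))) :=
    isRepresentedByBivectorOfRank_of_gauss hφ.symplectic (hφ.immersion o) (hφ.nondegenerate o)
      (L := hφ.transvectionLinear o) (hφ.transvectionLinear_skew hfull o)
      (fun x ξ hξ => hφ.transvectionLinear_mem_tangentImage hfull o x hξ)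
      (fun x y => hφ.transvectionLinear_mem_orthogonal hfull o x
        (modelDifferential_mem_tangentImage (E := E) φ o y))
      (hφ.transvectionLinear_symm hfull o)
      (fun ξ hξ hL => hφ.eq_zero_of_transvectionLinear_eq_zero hfull o hξ hL)
      (hφ.differential_curvature hfull o)
  rw [SymmetricSpaceStructure.symplecticCurvatureRank,
    hrep.bivectorRank_eq (hφ.isSymplecticForm_pullbackForm o),
    ← Submodule.finrank_add_eq_of_isCompl (hφ.symplectic.isCompl (hφ.nondegenerate o))]
  congr 1
  exact LinearMap.finrank_range_of_inj (hφ.immersion o)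

end IsExtrinsicSymplecticImmersion

/-! ### Reduction to a full immersion -/

/-- Linear symplectic reduction of a subspace `W`, realized on a complement `C` in `W` of the radical
of `Ω|_W`. -/
theorem IsSymplecticForm.exists_reduction {V : Type*} [AddCommGroup V] [Module ℝ V]
    {Ω : LinearMap.BilinForm ℝ V} (hΩ : IsSymplecticForm Ω) (W : Submodule ℝ V) :
    ∃ (C : Submodule ℝ V) (P : V →ₗ[ℝ] C), C ≤ W ∧ IsSymplecticForm (Ω.restrict C) ∧
      (∀ c : C, P c = c) ∧ ∀ u ∈ W, ∀ v ∈ W, Ω (P u) (P v) = Ω u v := by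
  set K : Submodule ℝ V := W ⊓ Ω.orthogonal W with hK
  obtain ⟨D, hD⟩ := K.exists_isCompl
  have hKW : ∀ k ∈ K, ∀ w ∈ W, Ω k w = 0 ∧ Ω w k = 0 := fun k hk w hw =>
    have h : Ω w k = 0 := hk.2 w hw
    ⟨by rw [hΩ.eq_neg, h, neg_zero], h⟩
  set p := D.projection K hD.symm with hp
  have hpD : ∀ v, p v ∈ D := fun v => Submodule.projection_apply_mem hD.symm v
  have hpK : ∀ v, v - p v ∈ K := fun v => by
    rw [← Submodule.projection_apply_eq_zero_iff hD.symm, map_sub, ← hp]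
    rw [hp, Submodule.projection_apply_left hD.symm ⟨_, hpD v⟩, sub_self]
  have hpW : ∀ w ∈ W, p w ∈ W ⊓ D := fun w hw =>
    ⟨by simpa using sub_mem hw (hpK w).1, hpD w⟩
  obtain ⟨P, hP⟩ := LinearMap.exists_extend
    ((p ∘ₗ W.subtype).codRestrict (W ⊓ D) fun w => hpW w w.2)
  have hPp : ∀ w ∈ W, (P w : V) = p w := fun w hw =>
    congrArg Subtype.val (LinearMap.congr_fun hP ⟨w, hw⟩)
  have hΩP : ∀ u ∈ W, ∀ v ∈ W, Ω (P u) (P v) = Ω u v := fun u hu v hv => by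
    rw [hPp u hu, hPp v hv]
    have h₁ := (hKW _ (hpK u) v hv).1
    have h₂ := (hKW _ (hpK v) (p u) (hpW u hu).1).2
    rw [map_sub, LinearMap.sub_apply, sub_eq_zero] at h₁
    rw [map_sub, sub_eq_zero] at h₂
    rw [h₁, h₂]
  have hfix : ∀ c : (W ⊓ D : Submodule ℝ V), P c = c := fun c => by
    ext
    rw [hPp c c.2.1]
    exact Submodule.projection_apply_left hD.symm ⟨c, c.2.2⟩
  have hnd : ∀ c ∈ W ⊓ D, (∀ c' ∈ W ⊓ D, Ω c' c = 0) → c = 0 := by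
    intro c hc h
    refine Submodule.disjoint_def.1 hD.disjoint c ⟨hc.1, fun w hw => ?_⟩ hc.2
    change Ω w c = 0
    rw [← hΩP w hw c hc.1, hfix ⟨c, hc⟩]
    exact h _ (P w).2
  refine ⟨W ⊓ D, P, inf_le_left, ⟨fun x => hΩ.isAlt _, fun x hx => ?_, fun x hx => ?_⟩, hfix, hΩP⟩
  · refine Subtype.ext (hnd x x.2 fun c hc => ?_)
    rw [hΩ.eq_neg, neg_eq_zero]
    exact hx ⟨c, hc⟩
  · exact Subtype.ext (hnd x x.2 fun c hc => hx ⟨c, hc⟩)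

theorem isFullMap_iff_span_eq_top {M V : Type*} [AddCommGroup V] [Module ℝ V] {φ : M → V} (o : M) :
    IsFullMap φ ↔ Submodule.span ℝ (Set.range fun q => φ q - φ o) = ⊤ := by
  constructor
  · intro h
    have hA := h (AffineSubspace.mk' (φ o) (Submodule.span ℝ (Set.range fun q => φ q - φ o)))
      fun q => AffineSubspace.mem_mk'.2 (Submodule.subset_span ⟨q, rfl⟩)
    rw [← AffineSubspace.direction_mk' (φ o)
      (Submodule.span ℝ (Set.range fun q => φ q - φ o)), hA, AffineSubspace.direction_top]
  · intro h A hA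
    rw [← AffineSubspace.direction_eq_top_iff_of_nonempty ⟨φ o, hA o⟩, eq_top_iff, ← h,
      Submodule.span_le]
    rintro _ ⟨q, rfl⟩
    exact AffineSubspace.vsub_mem_direction (hA q) (hA o)

namespace IsExtrinsicSymplecticImmersion

variable {E : Type*} [NormedAddCommGroup E] [NormedSpace ℝ E]
  {M : Type*} [TopologicalSpace M] [ChartedSpace E M] [IsManifold 𝓘(ℝ, E) ∞ M]
  {S : SymmetricSpaceStructure E M}
  {V : Type*} [NormedAddCommGroup V] [NormedSpace ℝ V] [FiniteDimensional ℝ V]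
  {Ω : LinearMap.BilinForm ℝ V} {φ : M → V}

/-- The tangent spaces lie in the direction of the affine span of the image. -/
theorem modelDifferential_mem_span (hφ : ContMDiff 𝓘(ℝ, E) 𝓘(ℝ, V) ∞ φ) (o p : M) (x : E) :
    modelDifferential φ p x ∈ Submodule.span ℝ (Set.range fun q => φ q - φ o) := by
  by_contra hx
  obtain ⟨f, hf, hker⟩ := Submodule.exists_le_ker_of_notMem hx
  apply hf
  set l : V →L[ℝ] ℝ := LinearMap.toContinuousLinearMap f with hl
  have hconst : ∀ q, l (φ q) = l (φ o) := fun q => by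
    have h : f (φ q - φ o) = 0 := hker (Submodule.subset_span ⟨q, rfl⟩)
    rwa [map_sub, sub_eq_zero] at h
  have h₁ := l.hasFDerivAt.comp _ (hφ.hasFDerivAt_comp_extChartAt_symm p)
  have h₂ := h₁.unique ((hasFDerivAt_const (l (φ o)) _).congr_of_eventuallyEq
    (Filter.Eventually.of_forall fun e => hconst _))
  exact congrArg (fun A : E →L[ℝ] ℝ => A x) h₂

/-- Every extrinsic symplectic immersion reduces to a full one that induces the same symplectic
form, by passing from `V` to the symplectic reduction of the direction of the affine span of the
image. -/
theorem exists_full_reduction (hφ : IsExtrinsicSymplecticImmersion S Ω φ) (o : M) :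
    ∃ (C : Submodule ℝ V) (Ω' : LinearMap.BilinForm ℝ C) (ψ : M → C),
      IsExtrinsicSymplecticImmersion S Ω' ψ ∧
      (∀ p : M, pullbackForm (E := E) ψ Ω' p = pullbackForm φ Ω p) ∧ IsFullMap ψ ∧
      (Module.finrank ℝ V ≤ Module.finrank ℝ C → IsFullMap φ) := by
  set W := Submodule.span ℝ (Set.range fun q => φ q - φ o) with hW
  obtain ⟨C, P, hCW, hC, hPC, hΩP⟩ := hφ.symplectic.exists_reduction W
  have hmem : ∀ q, φ q - φ o ∈ W := fun q => Submodule.subset_span ⟨q, rfl⟩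
  have hdW := modelDifferential_mem_span (E := E) hφ.contMDiff o
  set L : V →L[ℝ] C := LinearMap.toContinuousLinearMap P with hL
  set ψ : M → C := fun q => L (φ q - φ o) with hψ
  have hψs : ContMDiff 𝓘(ℝ, E) 𝓘(ℝ, C) ∞ ψ :=
    L.contDiff.contMDiff.comp (hφ.contMDiff.sub contMDiff_const)
  have hd : ∀ p x, modelDifferential (E := E) ψ p x = P (modelDifferential φ p x) := by
    intro p x
    have h := (hψs.hasFDerivAt_comp_extChartAt_symm p).unique (L.hasFDerivAt.comp _
      ((hφ.contMDiff.hasFDerivAt_comp_extChartAt_symm p).sub_const (φ o)))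
    exact congrArg (fun A : E →L[ℝ] C => A x) h
  have hpull : ∀ p x y, Ω (P (modelDifferential (E := E) φ p x))
      (P (modelDifferential (E := E) φ p y)) =
      Ω (modelDifferential (E := E) φ p x) (modelDifferential (E := E) φ p y) := fun p x y =>
    hΩP _ (hdW p x) _ (hdW p y)
  have hform : ∀ p : M, pullbackForm (E := E) ψ (Ω.restrict C) p = pullbackForm φ Ω p := by
    intro p
    have h : ∀ x y : E, Ω (modelDifferential (E := E) ψ p x) (modelDifferential (E := E) ψ p y) =
        Ω (modelDifferential (E := E) φ p x) (modelDifferential (E := E) φ p y) := fun x y => by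
      rw [hd, hd, hpull]
    exact LinearMap.ext fun x => LinearMap.ext fun y => h x y
  have himm : ∀ p : M, Function.Injective (differential (E := E) ψ p) := by
    intro p
    refine (injective_iff_map_eq_zero _).2 fun x hx => ?_
    refine (hφ.isSymplecticForm_pullbackForm p).nondegenerate.1 x fun y => ?_
    rw [← hform p]
    change Ω (differential (E := E) ψ p x) _ = 0
    rw [hx]
    simp
  have hnd : ∀ p : M, ((Ω.restrict C).restrict (tangentImage (E := E) ψ p)).Nondegenerate := by
    intro p
    have hs := (hφ.isSymplecticForm_pullbackForm p).nondegenerate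
    rw [← hform p] at hs
    constructor
    · rintro ⟨_, x, rfl⟩ hx
      have : x = 0 := hs.1 x fun y => hx ⟨_, y, rfl⟩
      subst this
      exact Subtype.ext (map_zero _)
    · rintro ⟨_, x, rfl⟩ hx
      have : x = 0 := hs.2 x fun y => hx ⟨_, y, rfl⟩
      subst this
      exact Subtype.ext (map_zero _)
  refine ⟨C, Ω.restrict C, ψ, ⟨hC, hψs, himm, hnd, fun p q => ?_⟩, hform, ?_, fun hle => ?_⟩
  · -- `P` maps the splitting of `φ q - φ p` into a tangent and a normal part to that of its image
    obtain ⟨t, ⟨x, rfl⟩, n, hn, htn⟩ :=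
      exists_eq_add_mem_orthogonal hφ.symplectic (hφ.nondegenerate p) (φ q - φ p)
    set t : V := differential (E := E) φ p x with ht
    have htT : t ∈ tangentImage (E := E) φ p := ⟨x, rfl⟩
    have htW : t ∈ W := hdW p x
    have hnW : n ∈ W := by
      have h₁ : φ q - φ p ∈ W := by simpa using sub_mem (hmem q) (hmem p)
      have h₂ : n = φ q - φ p - t := by rw [htn]; abel
      rw [h₂]
      exact sub_mem h₁ htW
    have h₁ : P t ∈ tangentImage (E := E) ψ p := ⟨x, hd p x⟩
    have h₂ : P n ∈ (Ω.restrict C).orthogonal (tangentImage (E := E) ψ p) := by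
      have h : ∀ y : E, Ω (modelDifferential (E := E) ψ p y) (P n) = 0 := fun y => by
        rw [hd, hΩP _ (hdW p y) _ hnW]
        exact hn _ (modelDifferential_mem_tangentImage φ p y)
      rintro _ ⟨y, rfl⟩
      exact h y
    have h₃ : ψ q - ψ p = P t + P n := by
      change P (φ q - φ o) - P (φ p - φ o) = _
      rw [← map_sub, sub_sub_sub_cancel_right, htn, map_add]
    have h₄ : φ (S.sym p q) - φ o = -t + n + (φ p - φ o) := by
      rw [hφ.reflection, symplecticReflection_apply, htn, map_add,
        symplecticReflectionLinear_of_mem _ _ htT,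
        symplecticReflectionLinear_of_mem_orthogonal _ _ hn]
      abel
    rw [symplecticReflection_apply, h₃, map_add, symplecticReflectionLinear_of_mem _ _ h₁,
      symplecticReflectionLinear_of_mem_orthogonal _ _ h₂]
    change P (φ (S.sym p q) - φ o) = _ + P (φ p - φ o)
    rw [h₄, map_add, map_add, map_neg]
  · rw [isFullMap_iff_span_eq_top o, eq_top_iff]
    rintro c -
    have hc : (c : V) ∈ W := hCW c.2
    have h₁ : P c ∈ W.map P := ⟨c, hc, rfl⟩
    rw [hPC, hW, Submodule.map_span] at h₁
    refine Submodule.span_mono ?_ h₁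
    rintro _ ⟨_, ⟨q, rfl⟩, rfl⟩
    refine ⟨q, ?_⟩
    change P (φ q - φ o) - P (φ o - φ o) = _
    rw [sub_self, map_zero, sub_zero]
  · rw [isFullMap_iff_span_eq_top o]
    exact Submodule.eq_top_of_finrank_eq (le_antisymm (Submodule.finrank_le _)
      (hle.trans (Submodule.finrank_mono hCW)))

end IsExtrinsicSymplecticImmersion

/-- An extrinsic symplectic immersion is full if and only if its ambient space has the smallest
dimension among the ambient spaces of all extrinsic symplectic immersions that induce the same
symplectic form; this smallest dimension is `dim M` plus the symplectic curvature rank. -/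
theorem corollaryD {E : Type u} [NormedAddCommGroup E] [NormedSpace ℝ E]
    [FiniteDimensional ℝ E]
    {M : Type w} [TopologicalSpace M] [ChartedSpace E M] [IsManifold 𝓘(ℝ, E) ∞ M]
    [T2Space M] [SecondCountableTopology M] [ConnectedSpace M]
    (S : SymmetricSpaceStructure E M)
    {V : Type v} [NormedAddCommGroup V] [NormedSpace ℝ V] [FiniteDimensional ℝ V]
    (Ω : LinearMap.BilinForm ℝ V) (φ : M → V)
    (hφ : IsExtrinsicSymplecticImmersion S Ω φ) :
    (IsFullMap φ ↔
      IsLeast (ambientDimensions.{u, w, v} S (pullbackForm φ Ω)) (Module.finrank ℝ V)) ∧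
    ∀ o : M, IsLeast (ambientDimensions.{u, w, v} S (pullbackForm φ Ω))
      (Module.finrank ℝ E + S.symplecticCurvatureRank o (pullbackForm φ Ω o)) := by
  have hleast : ∀ o : M, IsLeast (ambientDimensions.{u, w, v} S (pullbackForm φ Ω))
      (Module.finrank ℝ E + S.symplecticCurvatureRank o (pullbackForm φ Ω o)) := by
    intro o
    constructor
    · obtain ⟨C, Ω', ψ, hψ, hform, hfull, -⟩ := hφ.exists_full_reduction o
      refine ⟨C, inferInstance, inferInstance, inferInstance, Ω', ψ, hψ, hform, ?_⟩
      rw [hψ.finrank_eq_of_isFullMap hfull o, hform o]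
    · rintro n ⟨V', _, _, _, Ω', ψ, hψ, hform, rfl⟩
      obtain ⟨C, Ω'', χ, hχ, hform', hfull, -⟩ := hψ.exists_full_reduction o
      rw [← hform o, ← hform' o, ← hχ.finrank_eq_of_isFullMap hfull o]
      exact Submodule.finrank_le C
  obtain ⟨o⟩ : Nonempty M := inferInstance
  refine ⟨⟨fun hfull => ?_, fun h => ?_⟩, hleast⟩
  · rw [hφ.finrank_eq_of_isFullMap hfull o]
    exact hleast o
  · obtain ⟨C, Ω', ψ, hψ, hform, hfull, himp⟩ := hφ.exists_full_reduction o
    exact himp (h.2 ⟨C, inferInstance, inferInstance, inferInstance, Ω', ψ, hψ, hform, rfl⟩)
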